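/- Let $\mathbb F_q$ be a finite field with $q$ elements and write $(q^{-1})_m=\prod_{i=1}^m(1-q^{-i})$. A *partial isomorphism* of $(\mathbb F_q)^n$ is a pair of linear isomorphisms $(g_1:V\to W,\ g_2:W\to V)$ between two subspaces $V,W$ of $(\mathbb F_q)^n$; it is written $(V\,|\,g_1\rightleftarrows g_2\,|\,W)$, and its degree is $\dim V=\dim W$. Let $\mathscr A(n,\mathbb F_q)$ be the complex vector space with basis the partial isomorphisms of $(\mathbb F_q)^n$. An *extension* of $(V|g_1\rightleftarrows g_2|W)$ is a partial isomorphism $(V^+|g_1^+\rightleftarrows g_2^+|W^+)$ with $V\subset V^+$, $W\subset W^+$, $g_1^+|_V=g_1$, $g_2^+|_W=g_2$. It is *trivial in the split sense* if there are decompositions $V^+=V\oplus A$, $W^+=W\oplus B$ and an isomorphism $\psi:A\to B$ with $g_1^+=g_1\oplus\psi$, $g_2^+=g_2\oplus\psi^{-1}$; it is *trivial in the quotient sense* if the induced isomorphisms $V^+/V\to W^+/W$ and $W^+/W\to V^+/V$ are inverse of one another. For each of these two notions, let $*$ be the bilinear product on $\mathscr A(n,\mathbb F_q)$ for which $(U|g_1\rightleftarrows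 g_2|V)*(W|h_1\rightleftarrows h_2|X)$ is the mean of the partial isomorphisms $(U^+\,|\,h_1^+\circ g_1^+\rightleftarrows g_2^+\circ h_2^+\,|\,X^+)$ over all pairs consisting of a trivial extension $(U^+|g_1^+\rightleftarrows g_2^+|V+W)$ of the first factor and a trivial extension $(V+W|h_1^+\rightleftarrows h_2^+|X^+)$ of the second factor. The group $\mathrm{GL}(n,\mathbb F_q)$ acts on partial isomorphisms on the left and its opposite group acts on the right, by $k\cdot(V|g_1\rightleftarrows g_2|W)\cdot l=(k^{-1}(V)\,|\,l^{-1}\circ g_1\circ k\rightleftarrows k^{-1}\circ g_2\circ l\,|\,l^{-1}(W))$. Let $\mathscr Z(n,\mathbb F_q)\subset\mathscr A(n,\mathbb F_q)$ be the subspace of elements invariant under both actions, and $\mathscr Z_k(n,\mathbb F_q)$ its subspace of elements that are combinations of partial isomorphisms of degree $k$. A *polypartition* $\boldsymbol\mu$ is a finite family of partitions $\mu(P)$ labelled by monic irreducible polynomials $P\neq X$ over $\mathbb F_q$, of size $|\boldsymbol\mu|=\sum_P\deg P\,|\mu(P)|$; $J(\boldsymbol\mu)$ is the block-diagonal matrix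 whose blocks are the companion matrices of the $P^{j}$, $j$ running over the parts of $\mu(P)$. With $k=|\boldsymbol\mu|$, set $A_{\boldsymbol\mu,n}=\sum_{\mathcal E,\mathcal F}(\mathrm{Span}(\mathcal E)\,|\,I_k\rightleftarrows J(\boldsymbol\mu)\,|\,\mathrm{Span}(\mathcal F))$, the sum running over free families $\mathcal E,\mathcal F$ of $k$ vectors of $(\mathbb F_q)^n$ and the matrices being written in these bases. Let $\mathrm{card}\,A_{\boldsymbol\mu,n}$ be the number of terms of this sum, and $\widehat A_{\boldsymbol\mu,n}=A_{\boldsymbol\mu,n}/\sqrt{\mathrm{card}\,A_{\boldsymbol\mu,n}}$ (which is $0$ if $k>n$). For $n,p\ge 0$, with $(\mathbb F_q)^n\subset(\mathbb F_q)^{n+p}$ the span of the first $n$ vectors of the canonical basis, let $\phi^{n+p}_n:\mathscr A(n+p,\mathbb F_q)\to\mathscr A(n,\mathbb F_q)$ be the linear map that sends a partial isomorphism $(V|g_1\rightleftarrows g_2|W)$ of degree $k$ to $$q^{pk}\,\frac{(q^{-1})_{n+p}\,(q^{-1})_{n-k}}{(q^{-1})_{n+p-k}\,(q^{-1})_n}\,(V|g_1\rightleftarrows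 g_2|W)$$ if $V+W\subset(\mathbb F_q)^n$, and to $0$ otherwise. Then, for either notion of trivial extension: 1. $\mathscr Z(n,\mathbb F_q)$ is stable under $*$, and $*$ is commutative on it with unit $(\{0\}|\mathrm{id}\rightleftarrows\mathrm{id}|\{0\})\in\mathscr Z_0(n,\mathbb F_q)$; one has $\mathscr Z(n,\mathbb F_q)=\bigoplus_k\mathscr Z_k(n,\mathbb F_q)$ and $\mathscr Z_k*\mathscr Z_l\subset\bigoplus_{m\le k+l}\mathscr Z_m$. For the quotient notion, $*$ is moreover associative on $\mathscr Z(n,\mathbb F_q)$, which is thus a commutative algebra, graded in this sense. 2. $\phi^{n+p}_n$ maps $\mathscr Z(n+p,\mathbb F_q)$ onto $\mathscr Z(n,\mathbb F_q)$; on $\mathscr Z(n+p,\mathbb F_q)$ it is multiplicative for $*$, sends the unit to the unit, and maps $\mathscr Z_k(n+p,\mathbb F_q)$ into $\mathscr Z_k(n,\mathbb F_q)$ for every $k$. 3. For every polypartition $\boldsymbol\mu$, $\widehat A_{\boldsymbol\mu,n}\in\mathscr Z_{|\boldsymbol\mu|}(n,\mathbb F_q)$ and $\phi^{n+p}_n(\widehat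 A_{\boldsymbol\mu,n+p})=\widehat A_{\boldsymbol\mu,n}$; if $k=|\boldsymbol\mu|\le n$, then $\widehat A_{\boldsymbol\mu,n}=\frac{(q^{-1})_{n-k}}{q^{nk}(q^{-1})_n}A_{\boldsymbol\mu,n}$. 4. $\phi^n_n=\mathrm{id}$ and $\phi^m_n\circ\phi^N_m=\phi^N_n$ for $n\le m\le N$, so that the $\mathscr Z(n,\mathbb F_q)$ form an inverse system. -/

import Mathlib

open Polynomial

/-- A partial isomorphism `(V | g₁ ⇄ g₂ | W)` of the `F`-vector space `E`: two subspaces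
`V = left`, `W = right`, and two linear isomorphisms `g₁ : V → W`, `g₂ : W → V`. -/
structure PartialIso (F E : Type*) [Field F] [AddCommGroup E] [Module F E] where
  left : Submodule F E
  right : Submodule F E
  g₁ : left ≃ₗ[F] right
  g₂ : right ≃ₗ[F] left

/-- Two notions of "trivial" extension of a partial isomorphism. -/
inductive TrivialityNotion where
  | split
  | quotient

namespace PartialIso

section General

variable {F E : Type*} [Field F] [AddCommGroup E] [Module F E]

/-- The degree of a partial isomorphism: the dimension of its left (or right) subspace. -/
noncomputable def degree (G : PartialIso F E) : ℕ := Module.finrank F G.left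

/-- `G'` is an extension of `G`. -/
def IsExtension (G G' : PartialIso F E) : Prop :=
  ∃ (hl : G.left ≤ G'.left) (hr : G.right ≤ G'.right),
    (∀ x : G.left, (G'.g₁ (Submodule.inclusion hl x) : E) = G.g₁ x) ∧
    (∀ y : G.right, (G'.g₂ (Submodule.inclusion hr y) : E) = G.g₂ y)

/-- The extension `G'` of `G` is trivial in the split sense: `V⁺ = V ⊕ A`, `W⁺ = W ⊕ B`,
`g₁⁺ = g₁ ⊕ ψ` and `g₂⁺ = g₂ ⊕ ψ⁻¹` for some isomorphism `ψ : A → B`. -/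
def IsSplitExtension (G G' : PartialIso F E) : Prop :=
  IsExtension G G' ∧
  ∃ (A B : Submodule F E) (ψ : A ≃ₗ[F] B) (hA : A ≤ G'.left) (hB : B ≤ G'.right),
    (Disjoint G.left A ∧ G.left ⊔ A = G'.left) ∧
    (Disjoint G.right B ∧ G.right ⊔ B = G'.right) ∧
    (∀ a : A, (G'.g₁ (Submodule.inclusion hA a) : E) = ψ a) ∧
    (∀ b : B, (G'.g₂ (Submodule.inclusion hB b) : E) = ψ.symm b)

/-- The extension `G'` of `G` is trivial in the quotient sense: the isomorphisms
`V⁺/V → W⁺/W` and `W⁺/W → V⁺/V` induced by `g₁⁺` and `g₂⁺` are inverse of one another,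
that is, `g₂⁺ ∘ g₁⁺` is the identity of `V⁺` modulo `V`. -/
def IsQuotientTrivialExtension (G G' : PartialIso F E) : Prop :=
  IsExtension G G' ∧ ∀ x : G'.left, (G'.g₂ (G'.g₁ x) : E) - x ∈ G.left

/-- `G'` is a trivial extension of `G`, in the sense selected by `τ`. -/
def IsTrivialExtension (τ : TrivialityNotion) (G G' : PartialIso F E) : Prop :=
  match τ with
  | .split => IsSplitExtension G G'
  | .quotient => IsQuotientTrivialExtension G G'

/-- Trivial extensions of `G` whose right subspace is `Z` (the left one is free). -/
def RightExt (τ : TrivialityNotion) (G : PartialIso F E) (Z : Submodule F E) : Type _ :=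
  {G' : PartialIso F E // IsTrivialExtension τ G G' ∧ G'.right = Z}

/-- Trivial extensions of `G` whose left subspace is `Z` (the right one is free). -/
def LeftExt (τ : TrivialityNotion) (G : PartialIso F E) (Z : Submodule F E) : Type _ :=
  {G' : PartialIso F E // IsTrivialExtension τ G G' ∧ G'.left = Z}

/-- Composition of arrows `U ⇄ V` and `V ⇄ X`: first `g₁`, then `h₁`, and backwards first
`h₂`, then `g₂`. -/
def comp (G H : PartialIso F E) (h : G.right = H.left) : PartialIso F E where
  left := G.left
  right := H.right
  g₁ := (G.g₁.trans (LinearEquiv.ofEq _ _ h)).trans H.g₁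
  g₂ := (H.g₂.trans (LinearEquiv.ofEq _ _ h.symm)).trans G.g₂

/-- Transport of structure by automorphisms `a`, `b` of `E` acting on the left subspace and
on the right subspace respectively. -/
def transport (a b : E ≃ₗ[F] E) (G : PartialIso F E) : PartialIso F E where
  left := G.left.map (a : E →ₗ[F] E)
  right := G.right.map (b : E →ₗ[F] E)
  g₁ := ((a.submoduleMap G.left).symm.trans G.g₁).trans (b.submoduleMap G.right)
  g₂ := ((b.submoduleMap G.right).symm.trans G.g₂).trans (a.submoduleMap G.left)

/-- The two-sided action `k · (V | g₁ ⇄ g₂ | W) · l` of the linear group: the result is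
`(k⁻¹(V) | l⁻¹ ∘ g₁ ∘ k ⇄ k⁻¹ ∘ g₂ ∘ l | l⁻¹(W))`. -/
def biAct (k l : E ≃ₗ[F] E) (G : PartialIso F E) : PartialIso F E :=
  transport k.symm l.symm G

/-- The partial isomorphism `({0} | id ⇄ id | {0})`. -/
def empty : PartialIso F E where
  left := ⊥
  right := ⊥
  g₁ := LinearEquiv.refl F _
  g₂ := LinearEquiv.refl F _

/-- The partial isomorphism `(Span e | I ⇄ J | Span f)` given in the bases `e`, `f` by
`g₁ (e j) = f j` and `g₂ (f j) = ∑ i, J i j • e i`. -/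
noncomputable def ofFamilies {ι : Type*} [Fintype ι] [DecidableEq ι] (e f : ι → E)
    (he : LinearIndependent F e) (hf : LinearIndependent F f) (J : Matrix ι ι F)
    (hJ : IsUnit J.det) : PartialIso F E where
  left := Submodule.span F (Set.range e)
  right := Submodule.span F (Set.range f)
  g₁ := (Module.Basis.span he).equiv (Module.Basis.span hf) (Equiv.refl ι)
  g₂ := ((Module.Basis.span hf).equiv (Module.Basis.span he) (Equiv.refl ι)).trans
    (Matrix.toLinearEquiv (Module.Basis.span he) J hJ)

instance [Finite E] : Finite (PartialIso F E) := by
  have hS : Finite (Submodule F E) := Finite.of_injective _ SetLike.coe_injective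
  have hE : ∀ V W : Submodule F E, Finite (V ≃ₗ[F] W) := fun V W => DFunLike.finite _
  let f : PartialIso F E →
      (Σ V : Submodule F E, Σ W : Submodule F E, (V ≃ₗ[F] W) × (W ≃ₗ[F] V)) :=
    fun G => ⟨G.left, G.right, G.g₁, G.g₂⟩
  refine Finite.of_injective f ?_
  rintro ⟨V, W, a, b⟩ ⟨V', W', a', b'⟩ h
  simp only [f, Sigma.mk.injEq] at h
  obtain ⟨rfl, h⟩ := h
  simp only [heq_eq_eq, Sigma.mk.injEq] at h
  obtain ⟨rfl, h⟩ := h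
  simp only [heq_eq_eq, Prod.mk.injEq] at h
  obtain ⟨rfl, rfl⟩ := h
  rfl

noncomputable instance [Finite E] (τ : TrivialityNotion) (G : PartialIso F E)
    (Z : Submodule F E) : Fintype (RightExt τ G Z) :=
  have : Finite (RightExt τ G Z) := Subtype.finite
  Fintype.ofFinite _

noncomputable instance [Finite E] (τ : TrivialityNotion) (G : PartialIso F E)
    (Z : Submodule F E) : Fintype (LeftExt τ G Z) :=
  have : Finite (LeftExt τ G Z) := Subtype.finite
  Fintype.ofFinite _

end General

section Restriction

variable {F E E' : Type*} [Field F] [AddCommGroup E] [Module F E] [AddCommGroup E'] [Module F E']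

/-- For `ι` injective and `V ≤ range ι`, the isomorphism `ι⁻¹(V) → V` induced by `ι`. -/
noncomputable def comapEquiv (ι : E' →ₗ[F] E) (hι : Function.Injective ι) (V : Submodule F E)
    (hV : V ≤ LinearMap.range ι) : V.comap ι ≃ₗ[F] V :=
  (Submodule.equivMapOfInjective ι hι (V.comap ι)).trans
    (LinearEquiv.ofEq _ _ (Submodule.map_comap_eq_self hV))

/-- A partial isomorphism of `E` whose two subspaces lie in a subspace `E'` of `E` (embedded
by `ι`), seen as a partial isomorphism of `E'`. -/
noncomputable def restrict (ι : E' →ₗ[F] E) (hι : Function.Injective ι) (G : PartialIso F E)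
    (h : G.left ⊔ G.right ≤ LinearMap.range ι) : PartialIso F E' where
  left := G.left.comap ι
  right := G.right.comap ι
  g₁ := ((comapEquiv ι hι G.left (le_sup_left.trans h)).trans G.g₁).trans
    (comapEquiv ι hι G.right (le_sup_right.trans h)).symm
  g₂ := ((comapEquiv ι hι G.right (le_sup_right.trans h)).trans G.g₂).trans
    (comapEquiv ι hι G.left (le_sup_left.trans h)).symm

end Restriction

end PartialIso

section Algebra

variable (F : Type*) [Field F]

/-- The complex vector space `𝒜(n, F)` with basis the set of partial isomorphisms of `Fⁿ`.
Its product is `pmul` below (not the pointwise product of functions). -/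
abbrev PIAlg (n : ℕ) : Type _ := PartialIso F (Fin n → F) →₀ ℂ

variable {F}

/-- The product of two partial isomorphisms `(U ⇄ V)` and `(W ⇄ X)`: the mean, over the
trivial extensions `(U⁺ ⇄ V + W)` of the first one and `(V + W ⇄ X⁺)` of the second one, of
the composed partial isomorphisms `(U⁺ ⇄ X⁺)`. -/
noncomputable def basisMul [Finite F] (τ : TrivialityNotion) {n : ℕ}
    (G H : PartialIso F (Fin n → F)) : PIAlg F n :=
  ((Fintype.card (PartialIso.RightExt τ G (G.right ⊔ H.left)) : ℂ) *
      (Fintype.card (PartialIso.LeftExt τ H (G.right ⊔ H.left)) : ℂ))⁻¹ •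
    ∑ G' : PartialIso.RightExt τ G (G.right ⊔ H.left),
      ∑ H' : PartialIso.LeftExt τ H (G.right ⊔ H.left),
        Finsupp.single (PartialIso.comp G'.1 H'.1 (G'.2.2.trans H'.2.2.symm)) (1 : ℂ)

/-- The product of `𝒜(n, F)`, by bilinear extension. -/
noncomputable def pmul [Finite F] (τ : TrivialityNotion) {n : ℕ} :
    PIAlg F n →ₗ[ℂ] PIAlg F n →ₗ[ℂ] PIAlg F n :=
  Finsupp.linearCombination ℂ fun G => Finsupp.linearCombination ℂ fun H => basisMul τ G H

variable (F)

/-- The element `({0} | id ⇄ id | {0})` of `𝒜(n, F)`. -/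
noncomputable def pone (n : ℕ) : PIAlg F n := Finsupp.single PartialIso.empty 1

/-- `𝒵(n, F)`: the elements of `𝒜(n, F)` that are invariant under the action of `GL(n, F)` on
the left and of its opposite group on the right. -/
noncomputable def invariants (n : ℕ) : Submodule ℂ (PIAlg F n) where
  carrier := {x | ∀ k l : (Fin n → F) ≃ₗ[F] (Fin n → F),
    Finsupp.mapDomain (PartialIso.biAct k l) x = x}
  zero_mem' := fun _ _ => Finsupp.mapDomain_zero
  add_mem' := fun hx hy k l => by rw [Finsupp.mapDomain_add, hx k l, hy k l]
  smul_mem' := fun c x hx k l => by rw [Finsupp.mapDomain_smul, hx k l]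

/-- The homogeneous part of degree `k` of `𝒵(n, F)`. -/
noncomputable def invariantsDeg (n k : ℕ) : Submodule ℂ (PIAlg F n) :=
  invariants F n ⊓ Finsupp.supported ℂ ℂ {G : PartialIso F (Fin n → F) | G.degree = k}

/-- The cardinality `q` of `F`, as a complex number. -/
noncomputable def qC : ℂ := (Nat.card F : ℂ)

/-- The Pochhammer symbol `(q⁻¹)ₘ = (1 - q⁻¹)(1 - q⁻²) ⋯ (1 - q⁻ᵐ)`. -/
noncomputable def qPoch (m : ℕ) : ℂ := ∏ i ∈ Finset.range m, (1 - ((qC F)⁻¹) ^ (i + 1))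

/-- The standard embedding of `Fⁿ` in `Fᴺ`, `n ≤ N`, as the span of the first `n` vectors of the
canonical basis. -/
noncomputable def stdEmb {n N : ℕ} (h : n ≤ N) : (Fin n → F) →ₗ[F] (Fin N → F) :=
  Function.ExtendByZero.linearMap F (Fin.castLE h)

lemma stdEmb_injective {n N : ℕ} (h : n ≤ N) : Function.Injective (stdEmb F h) :=
  Function.extend_injective (Fin.castLE_injective h) _

open Classical in
/-- The map `φᴺₙ : 𝒜(N, F) → 𝒜(n, F)`, `n ≤ N`. With `p = N - n`, a partial isomorphism of degree
`k` with subspaces `V`, `W` is multiplied by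
`q^(p k) (q⁻¹)_N (q⁻¹)_(n-k) / ((q⁻¹)_(N-k) (q⁻¹)_n)` if `V + W ⊆ Fⁿ`, and sent to zero
otherwise. -/
noncomputable def phi {n N : ℕ} (h : n ≤ N) : PIAlg F N →ₗ[ℂ] PIAlg F n :=
  Finsupp.linearCombination ℂ fun G : PartialIso F (Fin N → F) =>
    if hG : G.left ⊔ G.right ≤ LinearMap.range (stdEmb F h) then
      Finsupp.single (G.restrict (stdEmb F h) (stdEmb_injective F h) hG)
        ((qC F) ^ ((N - n) * G.degree) *
          ((qPoch F N * qPoch F (n - G.degree)) / (qPoch F (N - G.degree) * qPoch F n)))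
    else 0

end Algebra

section Polypartitions

variable (F : Type*) [Field F]

/-- Polypartitions over `F`: finite families of partitions (finite multisets of positive
integers) labelled by monic irreducible polynomials different from `X`. A polynomial that is not
a label of the family carries the empty partition. -/
abbrev Polypartition : Type _ :=
  {P : F[X] // P.Monic ∧ Irreducible P ∧ P ≠ X} →₀ Multiset ℕ+

variable {F}

/-- The Jordan matrix (companion matrix) of a monic polynomial. -/
def jordanMatrix (P : F[X]) : Matrix (Fin P.natDegree) (Fin P.natDegree) F :=
  fun i j =>
    if (j : ℕ) + 1 = P.natDegree then -P.coeff i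
    else if (i : ℕ) = (j : ℕ) + 1 then 1 else 0

lemma isUnit_det_jordanMatrix (P : F[X]) (h0 : P.coeff 0 ≠ 0) : IsUnit (jordanMatrix P).det := by
  rw [← Matrix.isUnit_iff_isUnit_det, ← Matrix.mulVec_injective_iff_isUnit]
  rw [← Matrix.coe_mulVecLin, injective_iff_map_eq_zero]
  intro v hv
  rw [Matrix.mulVecLin_apply] at hv
  have hrow : ∀ i, ∑ j, jordanMatrix P i j * v j = 0 := fun i => congrFun hv i
  have hlast : ∀ j : Fin P.natDegree, (j : ℕ) + 1 = P.natDegree → v j = 0 := by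
    intro j hj
    have h1 := hrow ⟨0, by omega⟩
    rw [Finset.sum_eq_single j] at h1
    · simpa [jordanMatrix, hj, h0] using h1
    · intro b _ hb
      have hb' : (b : ℕ) + 1 ≠ P.natDegree := fun h => hb (Fin.ext (by omega))
      simp [jordanMatrix, hb']
    · simp
  funext j
  by_cases hj : (j : ℕ) + 1 = P.natDegree
  · exact hlast j hj
  · have h1 := hrow ⟨(j : ℕ) + 1, by omega⟩
    rw [Finset.sum_eq_single j] at h1
    · simpa [jordanMatrix, hj] using h1
    · intro b _ hb
      by_cases hb' : (b : ℕ) + 1 = P.natDegree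
      · simp [hlast b hb']
      · have : ¬ ((j : ℕ) = (b : ℕ)) := fun h => hb (Fin.ext h.symm)
        simp [jordanMatrix, hb', this]
    · simp

lemma coeff_zero_pow_ne_zero (P : F[X]) (hP : P.Monic ∧ Irreducible P ∧ P ≠ X) (j : ℕ) :
    (P ^ j).coeff 0 ≠ 0 := by
  rw [Polynomial.coeff_zero_eq_eval_zero, Polynomial.eval_pow]
  refine pow_ne_zero _ fun h => hP.2.2 ?_
  rw [← Polynomial.coeff_zero_eq_eval_zero, ← Polynomial.X_dvd_iff] at h
  exact (Polynomial.eq_of_monic_of_associated Polynomial.monic_X hP.1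
    (Polynomial.irreducible_X.associated_of_dvd hP.2.1 h)).symm

namespace Polypartition

/-- The size `|μ| = ∑ deg(P) |μ(P)|`. -/
noncomputable def size (μ : Polypartition F) : ℕ :=
  μ.sum fun P m => P.1.natDegree * (m.map fun j : ℕ+ => (j : ℕ)).sum

/-- The blocks of the Jordan matrix of `μ`: one for each label `P` and each part `j` of `μ(P)`,
with repetitions. -/
abbrev Block (μ : Polypartition F) : Type _ := (P : μ.support) × (μ P.1).ToType

/-- The polynomial `P ^ j` of a block. -/
noncomputable def blockPoly (μ : Polypartition F) (b : μ.Block) : F[X] := b.1.1.1 ^ (b.2.1 : ℕ)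

/-- The index set of the rows and columns of the Jordan matrix of `μ`; it has `|μ|` elements. -/
abbrev Idx (μ : Polypartition F) : Type _ := (b : μ.Block) × Fin (μ.blockPoly b).natDegree

open Classical in
/-- The block-diagonal Jordan matrix `J(μ)` with blocks `J(P ^ j)`. Its rows and columns are
indexed by `μ.Idx`, so that no order on the blocks has to be chosen. -/
noncomputable def jordan (μ : Polypartition F) : Matrix μ.Idx μ.Idx F :=
  Matrix.blockDiagonal' fun b : μ.Block => jordanMatrix (μ.blockPoly b)

open Classical in
lemma isUnit_det_jordan (μ : Polypartition F) : IsUnit μ.jordan.det := by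
  have h : ∀ b : μ.Block, IsUnit (jordanMatrix (μ.blockPoly b)).det := fun b =>
    isUnit_det_jordanMatrix _ (coeff_zero_pow_ne_zero _ b.1.1.2 _)
  refine Matrix.isUnit_det_of_right_inverse
    (B := Matrix.blockDiagonal' fun b : μ.Block => (jordanMatrix (μ.blockPoly b))⁻¹) ?_
  rw [jordan, ← Matrix.blockDiagonal'_mul]
  simp only [Matrix.mul_nonsing_inv _ (h _)]
  exact Matrix.blockDiagonal'_one

/-- Free families of vectors of `Fⁿ` of size `|μ|`, indexed as the columns of `J(μ)`. -/
def FreeFamily (μ : Polypartition F) (n : ℕ) : Type _ :=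
  {e : μ.Idx → (Fin n → F) // LinearIndependent F e}

noncomputable instance [Finite F] (μ : Polypartition F) (n : ℕ) : Fintype (μ.FreeFamily n) :=
  have : Finite (μ.FreeFamily n) := Subtype.finite
  Fintype.ofFinite _

open Classical in
/-- The class `A_{μ,n}`: the sum over all pairs `(e, f)` of free families of size `|μ|` of the
partial isomorphisms `(Span e | I ⇄ J(μ) | Span f)`. It is zero if `|μ| > n`. -/
noncomputable def classA [Finite F] (μ : Polypartition F) (n : ℕ) : PIAlg F n :=
  ∑ e : μ.FreeFamily n, ∑ f : μ.FreeFamily n,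
    Finsupp.single (PartialIso.ofFamilies e.1 f.1 e.2 f.2 μ.jordan μ.isUnit_det_jordan) 1

/-- The number of elements of `A_{μ,n}`, counted with multiplicity: the number of terms of the
sum that defines it. -/
noncomputable def cardA [Finite F] (μ : Polypartition F) (n : ℕ) : ℕ :=
  Fintype.card (μ.FreeFamily n × μ.FreeFamily n)

/-- The renormalized class `Â_{μ,n} = A_{μ,n} / √(card A_{μ,n})`, which is zero if `|μ| > n`. -/
noncomputable def hatA [Finite F] (μ : Polypartition F) (n : ℕ) : PIAlg F n :=
  ((Real.sqrt (μ.cardA n) : ℝ) : ℂ)⁻¹ • μ.classA n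

end Polypartition

end Polypartitions

/-! ### Transport and embedding of partial isomorphisms -/

namespace PartialIso

variable {F E E' : Type*} [Field F] [AddCommGroup E] [Module F E] [AddCommGroup E'] [Module F E']

/-! A partial isomorphism is studied through the automorphism `g₂ ∘ g₁` of its left subspace. Two
partial isomorphisms lie in the same orbit of the two-sided action exactly when these automorphisms
are isomorphic, so an invariant element is a function of that isomorphism class
(`mem_invariants_iff`). Pushing forward along `toAut` gives a linear map `toAutLin` to combinations
of partial automorphisms. The fibre over an automorphism of a `k`-dimensional subspace consists of
the injective linear maps from it to `Fⁿ`; there are `freeCount F n k` of them, a nonzero number, so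
`toAutLin` is injective on invariants (`toAutLin_injOn`). All algebraic identities are therefore
checked on partial automorphisms, whose product is the mean of compositions of trivial extensions to
the sum of the two subspaces.

That `toAutLin` respects products (`toAutLin_pmul`) rests on two facts. A trivial extension with
right subspace `Z` is the same as two independent data: a trivial extension of `g₁ ∘ g₂` to `Z` and
an injective extension of `g₂` to `Z`. And the composition of two extensions through `Z` has a `g₂ ∘
g₁` conjugate to the composition of the two automorphisms of `Z`. Both sides thus agree after
averaging over conjugations, which changes nothing for invariant elements.

Commutativity then holds because `γη` and `ηγ` are conjugate. Associativity, in the quotient sense,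
holds because both bracketings equal the mean over three independent extensions to the total sum
(`avg_ext_chain`): extensions to a larger space form a torsor under linear maps, and the means are
compared by a surjective group morphism.

Finally, the scalar in `phi` is the ratio of the fibre sizes for `Fᴺ` and `Fⁿ`. Hence `toAutLin`
turns `phi` into truncation to the partial automorphisms inside `Fⁿ` (`toAutLin_phi`), which is
multiplicative without any invariance assumption (`trunc_mul`). The same count of free families
normalizes `hatA`, whence its compatibility with `phi`. -/

lemma ext_of_values {G H : PartialIso F E} (hl : G.left = H.left) (hr : G.right = H.right)
    (h₁ : ∀ x (hx : x ∈ G.left) (hx' : x ∈ H.left), (G.g₁ ⟨x, hx⟩ : E) = H.g₁ ⟨x, hx'⟩)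
    (h₂ : ∀ x (hx : x ∈ G.right) (hx' : x ∈ H.right), (G.g₂ ⟨x, hx⟩ : E) = H.g₂ ⟨x, hx'⟩) :
    G = H := by
  obtain ⟨V, W, a, b⟩ := G
  obtain ⟨V', W', a', b'⟩ := H
  obtain rfl : V = V' := hl
  obtain rfl : W = W' := hr
  obtain rfl : a = a' := by
    ext x
    exact h₁ x x.2 x.2
  obtain rfl : b = b' := by
    ext x
    exact h₂ x x.2 x.2
  rfl

lemma g₁_congr {G H : PartialIso F E} (h : G = H) (x : E) (hx : x ∈ G.left) :
    (G.g₁ ⟨x, hx⟩ : E) = H.g₁ ⟨x, h ▸ hx⟩ := by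
  subst h; rfl

lemma g₂_congr {G H : PartialIso F E} (h : G = H) (x : E) (hx : x ∈ G.right) :
    (G.g₂ ⟨x, hx⟩ : E) = H.g₂ ⟨x, h ▸ hx⟩ := by
  subst h; rfl

section Transport

variable (a b : E ≃ₗ[F] E) (G : PartialIso F E)

lemma transport_g₁ (x : E) (hx : x ∈ G.left) (hx' : a x ∈ (transport a b G).left) :
    ((transport a b G).g₁ ⟨a x, hx'⟩ : E) = b (G.g₁ ⟨x, hx⟩) := by
  have : (⟨a x, hx'⟩ : (transport a b G).left) = a.submoduleMap G.left ⟨x, hx⟩ := rfl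
  rw [this]
  change ((b.submoduleMap G.right) (G.g₁
    ((a.submoduleMap G.left).symm ((a.submoduleMap G.left) ⟨x, hx⟩))) : E) = _
  rw [LinearEquiv.symm_apply_apply]
  rfl

lemma transport_g₂ (x : E) (hx : x ∈ G.right) (hx' : b x ∈ (transport a b G).right) :
    ((transport a b G).g₂ ⟨b x, hx'⟩ : E) = a (G.g₂ ⟨x, hx⟩) := by
  have : (⟨b x, hx'⟩ : (transport a b G).right) = b.submoduleMap G.right ⟨x, hx⟩ := rfl
  rw [this]
  change ((a.submoduleMap G.left) (G.g₂
    ((b.submoduleMap G.right).symm ((b.submoduleMap G.right) ⟨x, hx⟩))) : E) = _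
  rw [LinearEquiv.symm_apply_apply]
  rfl

/-- To recognise a transported partial isomorphism it suffices to check values. -/
lemma eq_transport {H : PartialIso F E} (hl : H.left = G.left.map (a : E →ₗ[F] E))
    (hr : H.right = G.right.map (b : E →ₗ[F] E))
    (h₁ : ∀ x (hx : x ∈ G.left) (hx' : a x ∈ H.left), (H.g₁ ⟨a x, hx'⟩ : E) = b (G.g₁ ⟨x, hx⟩))
    (h₂ : ∀ x (hx : x ∈ G.right) (hx' : b x ∈ H.right),
      (H.g₂ ⟨b x, hx'⟩ : E) = a (G.g₂ ⟨x, hx⟩)) : H = transport a b G := by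
  refine ext_of_values hl hr ?_ ?_
  · rintro _ hx ⟨x, hxG, rfl⟩
    exact (h₁ x hxG hx).trans (transport_g₁ a b G x hxG _).symm
  · rintro _ hx ⟨x, hxG, rfl⟩
    exact (h₂ x hxG hx).trans (transport_g₂ a b G x hxG _).symm

lemma transport_symm_transport : transport a.symm b.symm (transport a b G) = G := by
  refine (eq_transport _ _ _ ?_ ?_ ?_ ?_).symm
  · simp [transport, ← Submodule.map_comp]
  · simp [transport, ← Submodule.map_comp]
  · rintro _ ⟨x, hx, rfl⟩ hx'
    refine Eq.trans ?_ (congrArg b.symm (transport_g₁ a b G x hx ⟨x, hx, rfl⟩)).symm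
    simp
  · rintro _ ⟨x, hx, rfl⟩ hx'
    refine Eq.trans ?_ (congrArg a.symm (transport_g₂ a b G x hx ⟨x, hx, rfl⟩)).symm
    simp

lemma transport_transport_symm : transport a b (transport a.symm b.symm G) = G :=
  transport_symm_transport a.symm b.symm G

lemma transport_injective :
    Function.Injective (transport a b : PartialIso F E → PartialIso F E) :=
  Function.LeftInverse.injective (transport_symm_transport a b)

end Transport

/-- Image of a partial isomorphism by an injective linear map. -/
noncomputable def map (ι : E' →ₗ[F] E) (hι : Function.Injective ι) (G : PartialIso F E') :
    PartialIso F E where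
  left := G.left.map ι
  right := G.right.map ι
  g₁ := ((Submodule.equivMapOfInjective ι hι G.left).symm.trans G.g₁).trans
    (Submodule.equivMapOfInjective ι hι G.right)
  g₂ := ((Submodule.equivMapOfInjective ι hι G.right).symm.trans G.g₂).trans
    (Submodule.equivMapOfInjective ι hι G.left)

section Map

variable (ι : E' →ₗ[F] E) (hι : Function.Injective ι)

lemma map_g₁ (G : PartialIso F E') (x : E') (hx : x ∈ G.left) (hx' : ι x ∈ (map ι hι G).left) :
    ((map ι hι G).g₁ ⟨ι x, hx'⟩ : E) = ι (G.g₁ ⟨x, hx⟩) := by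
  have : (⟨ι x, hx'⟩ : (map ι hι G).left) = Submodule.equivMapOfInjective ι hι G.left ⟨x, hx⟩ := rfl
  rw [this]
  change ((Submodule.equivMapOfInjective ι hι G.right) (G.g₁
    ((Submodule.equivMapOfInjective ι hι G.left).symm
      ((Submodule.equivMapOfInjective ι hι G.left) ⟨x, hx⟩))) : E) = _
  rw [LinearEquiv.symm_apply_apply]
  rfl

lemma map_g₂ (G : PartialIso F E') (x : E') (hx : x ∈ G.right)
    (hx' : ι x ∈ (map ι hι G).right) :
    ((map ι hι G).g₂ ⟨ι x, hx'⟩ : E) = ι (G.g₂ ⟨x, hx⟩) := by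
  have : (⟨ι x, hx'⟩ : (map ι hι G).right) =
    Submodule.equivMapOfInjective ι hι G.right ⟨x, hx⟩ := rfl
  rw [this]
  change ((Submodule.equivMapOfInjective ι hι G.left) (G.g₂
    ((Submodule.equivMapOfInjective ι hι G.right).symm
      ((Submodule.equivMapOfInjective ι hι G.right) ⟨x, hx⟩))) : E) = _
  rw [LinearEquiv.symm_apply_apply]
  rfl

lemma eq_map {G : PartialIso F E'} {H : PartialIso F E} (hl : H.left = G.left.map ι)
    (hr : H.right = G.right.map ι)
    (h₁ : ∀ x (hx : x ∈ G.left) (hx' : ι x ∈ H.left), (H.g₁ ⟨ι x, hx'⟩ : E) = ι (G.g₁ ⟨x, hx⟩))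
    (h₂ : ∀ x (hx : x ∈ G.right) (hx' : ι x ∈ H.right),
      (H.g₂ ⟨ι x, hx'⟩ : E) = ι (G.g₂ ⟨x, hx⟩)) : H = map ι hι G := by
  refine ext_of_values hl hr ?_ ?_
  · rintro _ hx ⟨x, hxG, rfl⟩
    exact (h₁ x hxG hx).trans (map_g₁ ι hι G x hxG _).symm
  · rintro _ hx ⟨x, hxG, rfl⟩
    exact (h₂ x hxG hx).trans (map_g₂ ι hι G x hxG _).symm

lemma map_injective : Function.Injective (map ι hι) := by
  intro G H h
  have hl : G.left = H.left := Submodule.map_injective_of_injective hι (congrArg left h)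
  have hr : G.right = H.right := Submodule.map_injective_of_injective hι (congrArg right h)
  refine ext_of_values hl hr ?_ ?_
  · intro x hx hx'
    apply hι
    rw [← map_g₁ ι hι G x hx ⟨x, hx, rfl⟩, ← map_g₁ ι hι H x hx' ⟨x, hx', rfl⟩]
    exact g₁_congr h _ _
  · intro x hx hx'
    apply hι
    rw [← map_g₂ ι hι G x hx ⟨x, hx, rfl⟩, ← map_g₂ ι hι H x hx' ⟨x, hx', rfl⟩]
    exact g₂_congr h _ _

lemma map_map {E'' : Type*} [AddCommGroup E''] [Module F E''] (κ : E'' →ₗ[F] E')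
    (hκ : Function.Injective κ) (G : PartialIso F E'') :
    map ι hι (map κ hκ G) = map (ι ∘ₗ κ) (hι.comp hκ) G := by
  refine eq_map _ _ (Submodule.map_comp _ _ _).symm (Submodule.map_comp _ _ _).symm ?_ ?_
  · intro x hx hx'
    exact (map_g₁ ι hι (map κ hκ G) (κ x) ⟨x, hx, rfl⟩ hx').trans
      (congrArg ι (map_g₁ κ hκ G x hx _))
  · intro x hx hx'
    exact (map_g₂ ι hι (map κ hκ G) (κ x) ⟨x, hx, rfl⟩ hx').trans
      (congrArg ι (map_g₂ κ hκ G x hx _))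

lemma degree_map (G : PartialIso F E') : (map ι hι G).degree = G.degree :=
  (LinearEquiv.finrank_eq (Submodule.equivMapOfInjective ι hι G.left)).symm

lemma coe_comapEquiv_symm (V : Submodule F E) (hV : V ≤ LinearMap.range ι) (y : V) :
    ι ((comapEquiv ι hι V hV).symm y : E') = y := by
  obtain ⟨z, rfl⟩ := (comapEquiv ι hι V hV).surjective y
  simp [comapEquiv]

lemma map_restrict (G : PartialIso F E) (h : G.left ⊔ G.right ≤ LinearMap.range ι) :
    map ι hι (G.restrict ι hι h) = G := by
  refine (eq_map ι hι ?_ ?_ ?_ ?_).symm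
  · exact (Submodule.map_comap_eq_self (le_sup_left.trans h)).symm
  · exact (Submodule.map_comap_eq_self (le_sup_right.trans h)).symm
  · intro x hx hx'
    exact (coe_comapEquiv_symm ι hι G.right (le_sup_right.trans h) _).symm
  · intro x hx hx'
    exact (coe_comapEquiv_symm ι hι G.left (le_sup_left.trans h) _).symm

lemma map_left_sup_right_le (G : PartialIso F E') :
    (map ι hι G).left ⊔ (map ι hι G).right ≤ LinearMap.range ι :=
  sup_le LinearMap.map_le_range LinearMap.map_le_range

lemma restrict_map (G : PartialIso F E') (h : (map ι hι G).left ⊔ (map ι hι G).right ≤ _) :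
    (map ι hι G).restrict ι hι h = G :=
  map_injective ι hι (map_restrict ι hι _ h)

end Map

end PartialIso

/-! ### Means of finite families -/

section Average

variable {α β M M' : Type*} [Fintype α] [Fintype β] [AddCommGroup M] [Module ℂ M]
  [AddCommGroup M'] [Module ℂ M']

/-- The mean of a finite family of vectors. -/
noncomputable def avg (f : α → M) : M := (Fintype.card α : ℂ)⁻¹ • ∑ a, f a

lemma map_avg (L : M →ₗ[ℂ] M') (f : α → M) : L (avg f) = avg fun a => L (f a) := by
  simp [avg]

lemma map_avg₂ {M'' : Type*} [AddCommGroup M''] [Module ℂ M''] (L : M →ₗ[ℂ] M' →ₗ[ℂ] M'')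
    (f : α → M) (y : M') : L (avg f) y = avg fun a => L (f a) y := by
  simp [avg]

lemma avg_equiv (e : α ≃ β) (f : β → M) : (avg fun a => f (e a)) = avg f := by
  rw [avg, avg, Fintype.card_congr e, Equiv.sum_comp e f]

lemma avg_congr {f g : α → M} (h : ∀ a, f a = g a) : avg f = avg g := by
  rw [funext h]

lemma avg_const [Nonempty α] (m : M) : (avg fun _ : α => m) = m := by
  rw [avg, Finset.sum_const, Finset.card_univ, ← Nat.cast_smul_eq_nsmul ℂ, smul_smul,
    inv_mul_cancel₀ (by exact_mod_cast Fintype.card_ne_zero), one_smul]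

lemma avg_prod (f : α × β → M) : avg f = avg fun a => avg fun b => f (a, b) := by
  simp only [avg, Fintype.card_prod, Fintype.sum_prod_type, ← Finset.smul_sum, smul_smul]
  push_cast
  rw [mul_inv]

lemma avg_comm (f : α → β → M) :
    (avg fun a => avg fun b => f a b) = avg fun b => avg fun a => f a b := by
  simp only [avg, ← Finset.smul_sum]
  rw [Finset.sum_comm, smul_comm]

lemma sum_comp_addMonoidHom {A B N : Type*} [AddCommGroup A] [AddCommGroup B] [Fintype A]
    [Fintype B] [DecidableEq B] [AddCommMonoid N] (L : A →+ B) (hL : Function.Surjective L)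
    (f : B → N) :
    ∑ a, f (L a) = (Finset.univ.filter fun a => L a = 0).card • ∑ b, f b := by
  rw [← Finset.sum_fiberwise (s := Finset.univ) (g := L), Finset.smul_sum]
  refine Finset.sum_congr rfl fun b _ => ?_
  rw [← AddMonoidHom.card_fiber_eq_of_mem_range L (hL b) (hL 0), ← Finset.sum_const]
  refine Finset.sum_congr rfl fun a ha => ?_
  rw [(Finset.mem_filter.1 ha).2]

/-- The mean is preserved by surjective morphisms of finite groups. -/
lemma avg_addMonoidHom {A B : Type*} [AddCommGroup A] [AddCommGroup B] [Fintype A] [Fintype B]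
    (L : A →+ B) (hL : Function.Surjective L) (f : B → M) : (avg fun a => f (L a)) = avg f := by
  classical
  have hcard : Fintype.card A = (Finset.univ.filter fun a => L a = 0).card * Fintype.card B := by
    simpa using sum_comp_addMonoidHom L hL (fun _ => (1 : ℕ))
  have h0 : ((Finset.univ.filter fun a => L a = 0).card : ℂ) ≠ 0 := by
    have : (0 : A) ∈ Finset.univ.filter fun a => L a = 0 := by simp
    exact_mod_cast (Finset.card_pos.2 ⟨0, this⟩).ne'
  rw [avg, avg, sum_comp_addMonoidHom L hL f, hcard, ← Nat.cast_smul_eq_nsmul ℂ, smul_smul]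
  push_cast
  rw [mul_inv, mul_comm (_⁻¹), mul_assoc, inv_mul_cancel₀ h0, mul_one]

end Average

/-! ### Partial automorphisms, their trivial extensions and their product -/

/-- A partial automorphism of `E`: a subspace and a linear automorphism of it. -/
structure PartialAut (F E : Type*) [Field F] [AddCommGroup E] [Module F E] where
  space : Submodule F E
  g : space ≃ₗ[F] space

namespace PartialAut

variable {F E E' E'' : Type*} [Field F] [AddCommGroup E] [Module F E] [AddCommGroup E']
  [Module F E'] [AddCommGroup E''] [Module F E'']

lemma ext_of_values {p p' : PartialAut F E} (h : p.space = p'.space)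
    (hg : ∀ x (hx : x ∈ p.space) (hx' : x ∈ p'.space), (p.g ⟨x, hx⟩ : E) = p'.g ⟨x, hx'⟩) :
    p = p' := by
  obtain ⟨V, a⟩ := p
  obtain ⟨V', a'⟩ := p'
  obtain rfl : V = V' := h
  obtain rfl : a = a' := by
    ext x
    exact hg x x.2 x.2
  rfl

lemma g_congr {p p' : PartialAut F E} (h : p = p') (x : E) (hx : x ∈ p.space) :
    (p.g ⟨x, hx⟩ : E) = p'.g ⟨x, h ▸ hx⟩ := by
  subst h; rfl

/-- Two partial automorphisms are isomorphic if some linear isomorphism intertwines them. -/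
def Iso (p : PartialAut F E) (p' : PartialAut F E') : Prop :=
  ∃ φ : p.space ≃ₗ[F] p'.space, ∀ x, φ (p.g x) = p'.g (φ x)

lemma Iso.refl (p : PartialAut F E) : Iso p p := ⟨LinearEquiv.refl _ _, fun _ => rfl⟩

lemma Iso.symm {p : PartialAut F E} {p' : PartialAut F E'} (h : Iso p p') : Iso p' p := by
  obtain ⟨φ, hφ⟩ := h
  refine ⟨φ.symm, fun x => ?_⟩
  rw [LinearEquiv.symm_apply_eq, hφ, LinearEquiv.apply_symm_apply]

lemma Iso.trans {p : PartialAut F E} {p' : PartialAut F E'} {p'' : PartialAut F E''}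
    (h : Iso p p') (h' : Iso p' p'') : Iso p p'' := by
  obtain ⟨φ, hφ⟩ := h
  obtain ⟨ψ, hψ⟩ := h'
  exact ⟨φ.trans ψ, fun x => by simp [hφ, hψ]⟩

lemma Iso.finrank_eq {p : PartialAut F E} {p' : PartialAut F E'} (h : Iso p p') :
    Module.finrank F p.space = Module.finrank F p'.space :=
  h.choose.finrank_eq

/-- Conjugate of an automorphism of a subspace by an injective linear map. -/
noncomputable def mapEquiv (ι : E' →ₗ[F] E) (hι : Function.Injective ι) (S : Submodule F E') :
    (S ≃ₗ[F] S) ≃ (S.map ι ≃ₗ[F] S.map ι) where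
  toFun γ := ((Submodule.equivMapOfInjective ι hι S).symm.trans γ).trans
    (Submodule.equivMapOfInjective ι hι S)
  invFun γ := ((Submodule.equivMapOfInjective ι hι S).trans γ).trans
    (Submodule.equivMapOfInjective ι hι S).symm
  left_inv γ := by ext; simp
  right_inv γ := by ext; simp

/-- Image of a partial automorphism by an injective linear map. -/
noncomputable def map (ι : E' →ₗ[F] E) (hι : Function.Injective ι) (p : PartialAut F E') :
    PartialAut F E where
  space := p.space.map ι
  g := mapEquiv ι hι p.space p.g

section Map

variable (ι : E' →ₗ[F] E) (hι : Function.Injective ι)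

lemma mapEquiv_apply (S : Submodule F E') (γ : S ≃ₗ[F] S) (x : E') (hx : x ∈ S)
    (hx' : ι x ∈ S.map ι) : (mapEquiv ι hι S γ ⟨ι x, hx'⟩ : E) = ι (γ ⟨x, hx⟩) := by
  have : (⟨ι x, hx'⟩ : S.map ι) = Submodule.equivMapOfInjective ι hι S ⟨x, hx⟩ := rfl
  rw [this]
  change (Submodule.equivMapOfInjective ι hι S (γ ((Submodule.equivMapOfInjective ι hι S).symm
    (Submodule.equivMapOfInjective ι hι S ⟨x, hx⟩))) : E) = _
  rw [LinearEquiv.symm_apply_apply]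
  rfl

lemma mapEquiv_trans (S : Submodule F E') (γ η : S ≃ₗ[F] S) :
    (mapEquiv ι hι S γ).trans (mapEquiv ι hι S η) = mapEquiv ι hι S (γ.trans η) := by
  ext x
  simp [mapEquiv]

lemma map_g (p : PartialAut F E') (x : E') (hx : x ∈ p.space) (hx' : ι x ∈ (map ι hι p).space) :
    ((map ι hι p).g ⟨ι x, hx'⟩ : E) = ι (p.g ⟨x, hx⟩) :=
  mapEquiv_apply ι hι _ _ x hx hx'

lemma eq_map {p : PartialAut F E'} {p' : PartialAut F E} (h : p'.space = p.space.map ι)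
    (hg : ∀ x (hx : x ∈ p.space) (hx' : ι x ∈ p'.space),
      (p'.g ⟨ι x, hx'⟩ : E) = ι (p.g ⟨x, hx⟩)) : p' = map ι hι p := by
  refine ext_of_values h ?_
  rintro _ hx ⟨x, hxp, rfl⟩
  exact (hg x hxp hx).trans (map_g ι hι p x hxp _).symm

lemma map_injective : Function.Injective (map ι hι) := by
  intro p p' h
  refine ext_of_values (Submodule.map_injective_of_injective hι (congrArg space h)) ?_
  intro x hx hx'
  apply hι
  rw [← map_g ι hι p x hx ⟨x, hx, rfl⟩, ← map_g ι hι p' x hx' ⟨x, hx', rfl⟩]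
  exact g_congr h _ _

lemma iso_map (p : PartialAut F E') : Iso p (map ι hι p) := by
  refine ⟨Submodule.equivMapOfInjective ι hι p.space, fun x => ?_⟩
  ext
  exact (map_g ι hι p x x.2 _).symm

lemma exists_map_eq {p : PartialAut F E} (h : p.space ≤ LinearMap.range ι) :
    ∃ p' : PartialAut F E', map ι hι p' = p := by
  have hs : (p.space.comap ι).map ι = p.space := Submodule.map_comap_eq_self h
  let e : p.space.comap ι ≃ₗ[F] p.space :=
    (Submodule.equivMapOfInjective ι hι _).trans (LinearEquiv.ofEq _ _ hs)
  have he : ∀ x, (e x : E) = ι x := fun x => rfl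
  refine ⟨⟨p.space.comap ι, (e.trans p.g).trans e.symm⟩, (eq_map ι hι hs.symm ?_).symm⟩
  intro x hx hx'
  rw [← he]
  simp only [LinearEquiv.trans_apply, LinearEquiv.apply_symm_apply]
  rfl

/-- Isomorphic partial automorphisms of the same space are conjugate. -/
lemma Iso.exists_map_eq [FiniteDimensional F E] {p p' : PartialAut F E} (h : Iso p p') :
    ∃ a : E ≃ₗ[F] E, map (a : E →ₗ[F] E) a.injective p = p' := by
  obtain ⟨φ, hφ⟩ := h
  obtain ⟨a, ha⟩ := Submodule.exists_linearEquiv_restrict_eq φ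
  refine ⟨a, (eq_map _ _ ?_ ?_).symm⟩
  · ext y
    constructor
    · intro hy
      exact ⟨φ.symm ⟨y, hy⟩, (φ.symm ⟨y, hy⟩).2, by simpa using (ha (φ.symm ⟨y, hy⟩)).symm⟩
    · rintro ⟨x, hx, rfl⟩
      change a x ∈ _
      rw [← ha ⟨x, hx⟩]
      exact (φ _).2
  · intro x hx hx'
    have : (⟨(a : E →ₗ[F] E) x, hx'⟩ : p'.space) = φ ⟨x, hx⟩ := Subtype.ext (ha ⟨x, hx⟩).symm
    rw [this, ← hφ]
    exact ha _

end Map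

/-- The automorphism `γ` of `S` is a trivial extension of the partial automorphism `p`. -/
def IsTrivialOn (τ : TrivialityNotion) (p : PartialAut F E) {S : Submodule F E}
    (γ : S ≃ₗ[F] S) : Prop :=
  p.space ≤ S ∧
  (∀ x (hx : x ∈ p.space) (hS : x ∈ S), (γ ⟨x, hS⟩ : E) = p.g ⟨x, hx⟩) ∧
  match τ with
  | .split => ∃ B ≤ S, Disjoint p.space B ∧ p.space ⊔ B = S ∧
      ∀ x, x ∈ B → ∀ hS : x ∈ S, (γ ⟨x, hS⟩ : E) = x
  | .quotient => ∀ x : S, (γ x : E) - x ∈ p.space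

/-- The trivial extensions of `p` to `S`. -/
abbrev Ext (τ : TrivialityNotion) (p : PartialAut F E) (S : Submodule F E) : Type _ :=
  {γ : S ≃ₗ[F] S // IsTrivialOn τ p γ}

instance [Finite E] (τ : TrivialityNotion) (p : PartialAut F E) (S : Submodule F E) :
    Finite (Ext τ p S) :=
  have : Finite (S ≃ₗ[F] S) := DFunLike.finite _
  Subtype.finite

noncomputable instance [Finite E] (τ : TrivialityNotion) (p : PartialAut F E)
    (S : Submodule F E) : Fintype (Ext τ p S) := Fintype.ofFinite _

/-- Triviality of an extension to `S` is intrinsic to `S`: the ambient space plays no role. This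
serves both for conjugation, with `ι` an automorphism, and for the embedding of `Fⁿ` in `Fᴺ`. -/
lemma isTrivialOn_mapEquiv (τ : TrivialityNotion) (ι : E' →ₗ[F] E) (hι : Function.Injective ι)
    (p : PartialAut F E') {S : Submodule F E'} (γ : S ≃ₗ[F] S) :
    IsTrivialOn τ p γ ↔ IsTrivialOn τ (map ι hι p) (mapEquiv ι hι S γ) := by
  refine and_congr (Submodule.map_le_map_iff_of_injective hι _ _).symm (and_congr ?_ ?_)
  · constructor
    · rintro h _ ⟨x, hx, rfl⟩ hS
      have hxS : x ∈ S := (hι.mem_set_image (s := (S : Set E'))).1 hS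
      exact (mapEquiv_apply ι hι S γ x hxS hS).trans
        ((congrArg ι (h x hx hxS)).trans (map_g ι hι p x hx _).symm)
    · intro h x hx hS
      apply hι
      rw [← mapEquiv_apply ι hι S γ x hS ⟨x, hS, rfl⟩, ← map_g ι hι p x hx ⟨x, hx, rfl⟩]
      exact h _ _ _
  · cases τ with
    | split =>
      constructor
      · rintro ⟨B, hB, hd, hs, h⟩
        refine ⟨B.map ι, Submodule.map_mono hB, ?_, ?_, ?_⟩
        · exact (Submodule.disjoint_map hι hd)
        · exact (Submodule.map_sup _ _ _).symm.trans (congrArg _ hs)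
        · rintro _ ⟨x, hx, rfl⟩ hS
          have hxS : x ∈ S := hB hx
          exact (mapEquiv_apply ι hι S γ x hxS hS).trans (congrArg ι (h x hx hxS))
      -- A complement in `S.map ι` lies in the range of `ι`, so its preimage is the required
      -- complement in `S`.
      · rintro ⟨B, hB, hd, hs, h⟩
        have hB' : (B.comap ι).map ι = B :=
          Submodule.map_comap_eq_self (hB.trans LinearMap.map_le_range)
        refine ⟨B.comap ι, ?_, ?_, ?_, ?_⟩
        · intro x hx
          exact (hι.mem_set_image (s := (S : Set E'))).1 (hB hx)
        · rw [Submodule.disjoint_def] at hd ⊢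
          intro x hx hx'
          exact hι ((hd (ι x) ⟨x, hx, rfl⟩ hx').trans (map_zero ι).symm)
        · apply Submodule.map_injective_of_injective hι
          rw [Submodule.map_sup, hB']
          exact hs
        · intro x hx hS
          apply hι
          rw [← mapEquiv_apply ι hι S γ x hS ⟨x, hS, rfl⟩]
          exact h _ hx _
    | quotient =>
      constructor
      · rintro h ⟨_, x, hx, rfl⟩
        refine ⟨γ ⟨x, hx⟩ - x, h ⟨x, hx⟩, ?_⟩
        exact (map_sub _ _ _).trans
          (congrArg (· - ι x) (mapEquiv_apply ι hι S γ x hx ⟨x, hx, rfl⟩).symm)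
      · intro h x
        obtain ⟨y, hy, hy'⟩ := h ⟨ι x, ⟨x, x.2, rfl⟩⟩
        replace hy' := hy'.trans
          (congrArg (· - ι x) (mapEquiv_apply ι hι S γ x x.2 ⟨x, x.2, rfl⟩))
        rw [show (γ x : E') - x = y from hι (by rw [map_sub, hy'])]
        exact hy

/-- Trivial extensions are transported by injective linear maps. -/
noncomputable def extMapEquiv (τ : TrivialityNotion) (ι : E' →ₗ[F] E) (hι : Function.Injective ι)
    (p : PartialAut F E') (S : Submodule F E') : Ext τ p S ≃ Ext τ (map ι hι p) (S.map ι) :=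
  (mapEquiv ι hι S).subtypeEquiv fun γ => isTrivialOn_mapEquiv τ ι hι p γ

section Product

variable [Finite E] [Finite E'] (τ : TrivialityNotion)

/-- Mean of the compositions of the trivial extensions of `p` and `p'` to `S`. -/
noncomputable def mulOn (p p' : PartialAut F E) (S : Submodule F E) : PartialAut F E →₀ ℂ :=
  avg fun γ : Ext τ p S => avg fun η : Ext τ p' S => Finsupp.single ⟨S, γ.1.trans η.1⟩ 1

/-- Product of partial automorphisms: mean of the compositions of trivial extensions to the sum
of the two subspaces. -/
noncomputable def basisMul (p p' : PartialAut F E) : PartialAut F E →₀ ℂ :=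
  mulOn τ p p' (p.space ⊔ p'.space)

lemma basisMul_eq {p p' : PartialAut F E} {S : Submodule F E} (h : p.space ⊔ p'.space = S) :
    basisMul τ p p' = avg fun γ : Ext τ p S => avg fun η : Ext τ p' S =>
      Finsupp.single ⟨S, γ.1.trans η.1⟩ 1 := by
  subst h
  rfl

/-- Bilinear extension of the product of partial automorphisms. -/
noncomputable def mul :
    (PartialAut F E →₀ ℂ) →ₗ[ℂ] (PartialAut F E →₀ ℂ) →ₗ[ℂ] (PartialAut F E →₀ ℂ) :=
  Finsupp.linearCombination ℂ fun p => Finsupp.linearCombination ℂ fun p' => basisMul τ p p'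

lemma mul_single_single (p p' : PartialAut F E) (c c' : ℂ) :
    mul τ (Finsupp.single p c) (Finsupp.single p' c') = c • c' • basisMul τ p p' := by
  simp [mul]

/-- The target `S` is kept free of the two factors, so that extensions of each can be reindexed
separately by `extMapEquiv`. -/
lemma mulOn_map (ι : E' →ₗ[F] E) (hι : Function.Injective ι) (p p' : PartialAut F E')
    (S : Submodule F E') :
    mulOn τ (map ι hι p) (map ι hι p') (S.map ι) =
      Finsupp.lmapDomain ℂ ℂ (map ι hι) (mulOn τ p p' S) := by
  rw [mulOn, mulOn, ← avg_equiv (extMapEquiv τ ι hι p S), map_avg]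
  refine avg_congr fun γ => ?_
  rw [← avg_equiv (extMapEquiv τ ι hι p' S), map_avg]
  refine avg_congr fun η => ?_
  rw [Finsupp.lmapDomain_apply, Finsupp.mapDomain_single]
  congr 2
  exact mapEquiv_trans ι hι S γ.1 η.1

lemma basisMul_map (ι : E' →ₗ[F] E) (hι : Function.Injective ι) (p p' : PartialAut F E') :
    basisMul τ (map ι hι p) (map ι hι p') =
      Finsupp.lmapDomain ℂ ℂ (map ι hι) (basisMul τ p p') := by
  rw [basisMul, basisMul, ← mulOn_map, Submodule.map_sup]
  rfl

lemma mul_lmapDomain (ι : E' →ₗ[F] E) (hι : Function.Injective ι) (x y : PartialAut F E' →₀ ℂ) :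
    mul τ (Finsupp.lmapDomain ℂ ℂ (map ι hι) x) (Finsupp.lmapDomain ℂ ℂ (map ι hι) y) =
      Finsupp.lmapDomain ℂ ℂ (map ι hι) (mul τ x y) := by
  induction x using Finsupp.induction_linear with
  | zero => simp
  | add x x' hx hx' => simp only [map_add, LinearMap.add_apply, hx, hx']
  | single p c =>
    induction y using Finsupp.induction_linear with
    | zero => simp
    | add y y' hy hy' => simp only [map_add, hy, hy']
    | single p' c' =>
      simp only [Finsupp.lmapDomain_apply, Finsupp.mapDomain_single, mul_single_single,
        Finsupp.mapDomain_smul]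
      rw [basisMul_map]
      rfl

end Product

end PartialAut

namespace PartialAut

variable {F E E' : Type*} [Field F] [AddCommGroup E] [Module F E] [AddCommGroup E'] [Module F E']

lemma map_map_equiv (a b : E ≃ₗ[F] E) (p : PartialAut F E) :
    map (b : E →ₗ[F] E) b.injective (map (a : E →ₗ[F] E) a.injective p) =
      map ((a.trans b : E ≃ₗ[F] E) : E →ₗ[F] E) (a.trans b).injective p := by
  refine eq_map _ _ (by simp [map, ← Submodule.map_comp]) ?_
  intro x hx hx'
  refine (map_g (b : E →ₗ[F] E) b.injective (map (a : E →ₗ[F] E) a.injective p) (a x)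
    ⟨x, hx, rfl⟩ hx').trans ?_
  exact congrArg b (map_g (a : E →ₗ[F] E) a.injective p x hx ⟨x, hx, rfl⟩)

/-! ### Averaging over conjugations, and commutativity -/

section Conjugation

/-- Linear action of an automorphism of `E` on combinations of partial automorphisms. -/
noncomputable def conjMap (a : E ≃ₗ[F] E) : (PartialAut F E →₀ ℂ) →ₗ[ℂ] (PartialAut F E →₀ ℂ) :=
  Finsupp.lmapDomain ℂ ℂ (map (a : E →ₗ[F] E) a.injective)

lemma conjMap_single (a : E ≃ₗ[F] E) (p : PartialAut F E) (c : ℂ) :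
    conjMap a (Finsupp.single p c) = Finsupp.single (map (a : E →ₗ[F] E) a.injective p) c := by
  simp [conjMap, Finsupp.mapDomain_single]

lemma conjMap_conjMap (a b : E ≃ₗ[F] E) (z : PartialAut F E →₀ ℂ) :
    conjMap b (conjMap a z) = conjMap (a.trans b) z := by
  induction z using Finsupp.induction_linear with
  | zero => simp
  | add x y hx hy => simp only [_root_.map_add, hx, hy]
  | single p c => simp only [conjMap_single, map_map_equiv]

variable [Finite E]

noncomputable instance : Fintype (E ≃ₗ[F] E) :=
  have : Finite (E ≃ₗ[F] E) := DFunLike.finite _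
  Fintype.ofFinite _

variable (F E) in
/-- Mean over the conjugations by the linear group. -/
noncomputable def conjMean : (PartialAut F E →₀ ℂ) →ₗ[ℂ] (PartialAut F E →₀ ℂ) :=
  avg fun a : E ≃ₗ[F] E => conjMap a

lemma conjMean_apply (z : PartialAut F E →₀ ℂ) :
    conjMean F E z = avg fun a : E ≃ₗ[F] E => conjMap a z :=
  map_avg (LinearMap.applyₗ (R := ℂ) z) _

lemma conjMean_of_invariant {z : PartialAut F E →₀ ℂ}
    (hz : ∀ a : E ≃ₗ[F] E, conjMap a z = z) : conjMean F E z = z := by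
  rw [conjMean_apply, avg_congr hz]
  have : Nonempty (E ≃ₗ[F] E) := ⟨LinearEquiv.refl _ _⟩
  exact avg_const z

lemma conjMean_conjMap (b : E ≃ₗ[F] E) (z : PartialAut F E →₀ ℂ) :
    conjMean F E (conjMap b z) = conjMean F E z := by
  -- Translation in the linear group, which absorbs `b` in the mean.
  let e : (E ≃ₗ[F] E) ≃ (E ≃ₗ[F] E) :=
    ⟨fun a => b.symm.trans a, fun a => b.trans a, fun a => by ext; simp, fun a => by ext; simp⟩
  rw [conjMean_apply, conjMean_apply, ← avg_equiv e]
  refine avg_congr fun a => (conjMap_conjMap b (b.symm.trans a) z).trans ?_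
  exact congrArg (fun c => conjMap c z)
    (LinearEquiv.ext fun x => by simp : b.trans (b.symm.trans a) = a)

/-- In finite dimension an isomorphism between two subspaces extends to an automorphism of `E`, so
isomorphic partial automorphisms are conjugate and the mean does not separate them. -/
lemma Iso.conjMean_eq {p p' : PartialAut F E} (h : Iso p p') (c : ℂ) :
    conjMean F E (Finsupp.single p c) = conjMean F E (Finsupp.single p' c) := by
  have : FiniteDimensional F E := Module.Finite.of_finite
  obtain ⟨a, rfl⟩ := h.exists_map_eq
  rw [← conjMap_single, conjMean_conjMap]

variable (τ : TrivialityNotion)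

lemma conjMap_mul (a : E ≃ₗ[F] E) (x y : PartialAut F E →₀ ℂ) :
    conjMap a (mul τ x y) = mul τ (conjMap a x) (conjMap a y) :=
  (mul_lmapDomain τ (a : E →ₗ[F] E) a.injective x y).symm

/-- The automorphism `γ` itself intertwines the two orders of composition of `γ` and `η`, so they
become equal after averaging over conjugations. -/
lemma conjMean_mulOn_comm (p p' : PartialAut F E) (S : Submodule F E) :
    conjMean F E (mulOn τ p p' S) = conjMean F E (mulOn τ p' p S) := by
  simp only [mulOn, map_avg]
  rw [avg_comm]
  refine avg_congr fun η => avg_congr fun γ => ?_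
  exact Iso.conjMean_eq ⟨γ.1, fun x => rfl⟩ 1

lemma conjMean_mul_comm (x y : PartialAut F E →₀ ℂ) :
    conjMean F E (mul τ x y) = conjMean F E (mul τ y x) := by
  induction x using Finsupp.induction_linear with
  | zero => simp
  | add x x' hx hx' => simp only [_root_.map_add, LinearMap.add_apply, hx, hx']
  | single p c =>
    induction y using Finsupp.induction_linear with
    | zero => simp
    | add y y' hy hy' => simp only [_root_.map_add, LinearMap.add_apply, hy, hy']
    | single p' c' =>
      simp only [mul_single_single, _root_.map_smul, basisMul]
      rw [conjMean_mulOn_comm, sup_comm, smul_comm]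

/-- The product of conjugation invariant elements is commutative. -/
lemma mul_comm_of_invariant {x y : PartialAut F E →₀ ℂ}
    (hx : ∀ a : E ≃ₗ[F] E, conjMap a x = x) (hy : ∀ a : E ≃ₗ[F] E, conjMap a y = y) :
    mul τ x y = mul τ y x := by
  rw [← conjMean_of_invariant (z := mul τ x y) fun a => by rw [conjMap_mul, hx, hy],
    ← conjMean_of_invariant (z := mul τ y x) fun a => by rw [conjMap_mul, hx, hy],
    conjMean_mul_comm]

end Conjugation

/-! ### The unit among partial automorphisms -/

section Unit

variable (τ : TrivialityNotion)

variable (F E) in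
/-- The automorphism of the zero subspace. -/
def bot : PartialAut F E := ⟨⊥, LinearEquiv.refl F _⟩

lemma Ext.eq_self (p : PartialAut F E) (γ : Ext τ p p.space) : γ.1 = p.g := by
  ext x
  exact γ.2.2.1 x x.2 x.2

lemma isTrivialOn_self (p : PartialAut F E) : IsTrivialOn τ p p.g := by
  refine ⟨le_rfl, fun x hx hS => rfl, ?_⟩
  cases τ with
  | split =>
    refine ⟨⊥, bot_le, disjoint_bot_right, sup_bot_eq _, ?_⟩
    rintro x hx hS
    obtain rfl := (Submodule.mem_bot F).1 hx
    exact congrArg Subtype.val (map_zero p.g)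
  | quotient => exact fun x => Submodule.sub_mem _ (p.g x).2 x.2

/-- Over the zero subspace both notions of triviality force the identity: the complement `B` is all
of `S`, or the differences `γ x - x` lie in `0`. -/
lemma Ext.eq_refl_of_bot {S : Submodule F E} (γ : Ext τ (bot F E) S) :
    γ.1 = LinearEquiv.refl F S := by
  ext x
  obtain ⟨γ, h1, h2, h3⟩ := γ
  cases τ with
  | split =>
    obtain ⟨B, hB, -, hs, h⟩ := h3
    refine h x ?_ x.2
    have hx : (x : E) ∈ (bot F E).space ⊔ B := hs.symm ▸ x.2
    simpa [bot] using hx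
  | quotient => exact sub_eq_zero.1 ((Submodule.mem_bot F).1 (h3 x))

lemma isTrivialOn_bot_refl (S : Submodule F E) :
    IsTrivialOn τ (bot F E) (LinearEquiv.refl F S) := by
  refine ⟨bot_le, fun x hx hS => rfl, ?_⟩
  cases τ with
  | split => exact ⟨S, le_rfl, disjoint_bot_left, bot_sup_eq _, fun x hx hS => rfl⟩
  | quotient => exact fun x => by simp

variable [Finite E]

lemma basisMul_bot (p : PartialAut F E) : basisMul τ (bot F E) p = Finsupp.single p 1 := by
  have h : (bot F E).space ⊔ p.space = p.space := bot_sup_eq _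
  have : Nonempty (Ext τ (bot F E) p.space) := ⟨⟨_, isTrivialOn_bot_refl τ _⟩⟩
  have : Nonempty (Ext τ p p.space) := ⟨⟨_, isTrivialOn_self τ p⟩⟩
  rw [basisMul, h, mulOn]
  have : ∀ (γ : Ext τ (bot F E) p.space) (η : Ext τ p p.space),
      Finsupp.single (⟨p.space, γ.1.trans η.1⟩ : PartialAut F E) (1 : ℂ) = Finsupp.single p 1 := by
    intro γ η
    rw [Ext.eq_refl_of_bot τ γ, Ext.eq_self τ p η]
    rfl
  simp only [this, avg_const]

lemma mul_bot (x : PartialAut F E →₀ ℂ) : mul τ (Finsupp.single (bot F E) 1) x = x := by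
  induction x using Finsupp.induction_linear with
  | zero => simp
  | add x y hx hy => rw [_root_.map_add, hx, hy]
  | single p c => rw [mul_single_single, basisMul_bot]; simp

end Unit

/-! ### Associativity for the quotient notion -/

section Associativity

variable {T S : Submodule F E}

variable (T S) in
/-- Linear maps on `S` that vanish on `T` and take their values in `V`. -/
def vanishing (V : Submodule F E) : AddSubgroup (S →ₗ[F] E) where
  carrier := {a | (∀ s : S, (s : E) ∈ T → a s = 0) ∧ ∀ s, a s ∈ V}
  zero_mem' := ⟨fun _ _ => rfl, fun _ => V.zero_mem⟩
  add_mem' := fun ha hb => ⟨fun s hs => by simp [ha.1 s hs, hb.1 s hs],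
    fun s => V.add_mem (ha.2 s) (hb.2 s)⟩
  neg_mem' := fun ha => ⟨fun s hs => by simp [ha.1 s hs], fun s => V.neg_mem (ha.2 s)⟩

instance [Finite E] (V : Submodule F E) : Finite (vanishing T S V) :=
  have : Finite (S →ₗ[F] E) := DFunLike.finite _
  Subtype.finite

noncomputable instance [Finite E] (V : Submodule F E) : Fintype (vanishing T S V) :=
  Fintype.ofFinite _

/-- The endomorphism of `S` equal to `γ` on `T`, to `1 + a` on the kernel of the projection
`π : S → T`. -/
def extendEnd (hTS : T ≤ S) (π : S →ₗ[F] T) (γ : T ≃ₗ[F] T) (a : vanishing T S T) :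
    S →ₗ[F] S :=
  LinearMap.codRestrict S
    (T.subtype ∘ₗ γ.toLinearMap ∘ₗ π + (S.subtype - T.subtype ∘ₗ π) + a.1) fun s =>
      S.add_mem (S.add_mem (hTS (γ (π s)).2) (S.sub_mem s.2 (hTS (π s).2))) (hTS (a.2.2 s))

lemma coe_extendEnd (hTS : T ≤ S) (π : S →ₗ[F] T) (γ : T ≃ₗ[F] T) (a : vanishing T S T) (s : S) :
    (extendEnd hTS π γ a s : E) = γ (π s) + (s - π s) + a.1 s := rfl

variable (hTS : T ≤ S) (π : S →ₗ[F] T) (hπ : ∀ t : T, π ⟨t, hTS t.2⟩ = t)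

include hπ in
-- The map is the identity modulo `T`, so its kernel lies in `T`, where it coincides with the
-- injective `γ`.
lemma extendEnd_injective (γ : T ≃ₗ[F] T) (a : vanishing T S T) :
    Function.Injective (extendEnd hTS π γ a) := by
  rw [injective_iff_map_eq_zero]
  intro s hs
  have h : (γ (π s) : E) + (s - π s) + a.1 s = 0 := by
    rw [← coe_extendEnd hTS, hs]; rfl
  have hsT : (s : E) ∈ T := by
    have : (s : E) = π s - γ (π s) - a.1 s := by
      rw [← sub_eq_zero, ← h]
      abel
    rw [this]
    exact T.sub_mem (T.sub_mem (π s).2 (γ (π s)).2) (a.2.2 s)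
  have hπs : π s = ⟨s, hsT⟩ := hπ ⟨s, hsT⟩
  rw [a.2.1 s hsT, hπs] at h
  have h' : γ ⟨s, hsT⟩ = 0 := Subtype.ext (by simpa using h)
  have hs0 : (s : E) = 0 := by simpa using (map_eq_zero_iff γ γ.injective).1 h'
  exact Subtype.ext hs0

/-- The automorphism of `S` with underlying map `extendEnd`. -/
noncomputable def extendEquiv [FiniteDimensional F E] (γ : T ≃ₗ[F] T)
    (a : vanishing T S T) : S ≃ₗ[F] S :=
  LinearEquiv.ofInjectiveEndo _ (extendEnd_injective hTS π hπ γ a)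

lemma coe_extendEquiv [FiniteDimensional F E] (γ : T ≃ₗ[F] T) (a : vanishing T S T) (s : S) :
    (extendEquiv hTS π hπ γ a s : E) = γ (π s) + (s - π s) + a.1 s := rfl

variable {p p' : PartialAut F E} (hp : p.space ≤ T) (hp' : p'.space ≤ T)

/-- Inclusion of `vanishing T S V` in `vanishing T S V'` for `V ≤ V'`. -/
def vanishingIncl {V V' : Submodule F E} (h : V ≤ V') (a : vanishing T S V) : vanishing T S V' :=
  ⟨a.1, a.2.1, fun s => h (a.2.2 s)⟩

/-- The vanishing part of the composition of two extended automorphisms. -/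
noncomputable def vanishingComb (η : T ≃ₗ[F] T) :
    vanishing T S p.space × vanishing T S p'.space →+ vanishing T S T where
  toFun x := ⟨T.subtype ∘ₗ η.toLinearMap ∘ₗ LinearMap.codRestrict T x.1.1
      (fun s => hp (x.1.2.2 s)) + x.2.1, by
    refine ⟨fun s hs => ?_, fun s => ?_⟩
    · have h1 : LinearMap.codRestrict T x.1.1 (fun s => hp (x.1.2.2 s)) s = 0 :=
        Subtype.ext (x.1.2.1 s hs)
      simp [h1, x.2.2.1 s hs]
    · exact T.add_mem (η _).2 (hp' (x.2.2.2 s))⟩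
  map_zero' := by
    refine Subtype.ext (LinearMap.ext fun s => ?_)
    have h1 : LinearMap.codRestrict T (0 : S →ₗ[F] E) (fun _ => T.zero_mem) s = 0 := rfl
    change (η (LinearMap.codRestrict T (0 : S →ₗ[F] E) (fun _ => T.zero_mem) s) : E) + 0 = 0
    simp [h1]
  map_add' := by
    intro x y
    refine Subtype.ext (LinearMap.ext fun s => ?_)
    change (η (⟨x.1.1 s, hp (x.1.2.2 s)⟩ + ⟨y.1.1 s, hp (y.1.2.2 s)⟩ : T) : E) +
      (x.2.1 s + y.2.1 s) = (η ⟨x.1.1 s, hp (x.1.2.2 s)⟩ + x.2.1 s) +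
        (η ⟨y.1.1 s, hp (y.1.2.2 s)⟩ + y.2.1 s)
    rw [_root_.map_add, Submodule.coe_add]
    abel

lemma coe_vanishingComb (η : T ≃ₗ[F] T) (a : vanishing T S p.space) (b : vanishing T S p'.space)
    (s : S) : (vanishingComb hp hp' η (a, b)).1 s = η ⟨a.1 s, hp (a.2.2 s)⟩ + b.1 s := rfl

variable [FiniteDimensional F E]

lemma coe_extendEquiv_of_mem (γ : T ≃ₗ[F] T) (a : vanishing T S T) (x : E) (hx : x ∈ T) :
    (extendEquiv hTS π hπ γ a ⟨x, hTS hx⟩ : E) = γ ⟨x, hx⟩ := by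
  rw [coe_extendEquiv, hπ ⟨x, hx⟩, a.2.1 _ hx]
  simp

lemma isTrivialOn_extendEquiv (γ : Ext .quotient p T) (a : vanishing T S p.space) :
    IsTrivialOn .quotient p (extendEquiv hTS π hπ γ.1 (vanishingIncl hp a)) := by
  refine ⟨hp.trans hTS, fun x hx hS => ?_, fun s => ?_⟩
  · rw [coe_extendEquiv_of_mem hTS π hπ _ _ x (hp hx)]
    exact γ.2.2.1 x hx _
  · rw [coe_extendEquiv]
    have h1 : (γ.1 (π s) : E) - π s ∈ p.space := γ.2.2.2 (π s)
    have h2 : (vanishingIncl hp a).1 s ∈ p.space := a.2.2 s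
    convert p.space.add_mem h1 h2 using 1
    abel

/-- Extending to `T`, then to `S`. -/
noncomputable def chainMap (x : Ext .quotient p T × vanishing T S p.space) :
    Ext .quotient p S :=
  ⟨extendEquiv hTS π hπ x.1.1 (vanishingIncl hp x.2), isTrivialOn_extendEquiv hTS π hπ hp _ _⟩

/-- Once the projection `π` is fixed, the extensions to `S` with given restriction to `T` form a
torsor under the maps `S/T → p.space`. The size of the fibres does not depend on the restriction,
which makes uniform means factor. -/
lemma chainMap_bijective : Function.Bijective (chainMap hTS π hπ hp) := by
  constructor
  · rintro ⟨γ, a⟩ ⟨γ', a'⟩ h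
    have h' : ∀ s, (extendEquiv hTS π hπ γ.1 (vanishingIncl hp a) s : E) =
        extendEquiv hTS π hπ γ'.1 (vanishingIncl hp a') s := fun s => by
      rw [show extendEquiv hTS π hπ γ.1 (vanishingIncl hp a) =
        extendEquiv hTS π hπ γ'.1 (vanishingIncl hp a') from congrArg Subtype.val h]
    have hγ : γ = γ' := by
      refine Subtype.ext (LinearEquiv.ext fun t => Subtype.ext ?_)
      have := h' ⟨t, hTS t.2⟩
      rwa [coe_extendEquiv_of_mem hTS π hπ _ _ t t.2,
        coe_extendEquiv_of_mem hTS π hπ _ _ t t.2] at this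
    subst hγ
    refine Prod.ext rfl (Subtype.ext (LinearMap.ext fun s => ?_))
    have := h' s
    rw [coe_extendEquiv, coe_extendEquiv] at this
    exact add_left_cancel this
  · intro δ
    -- An extension moves each vector by an element of `p.space ≤ T`, hence preserves `T` and can be
    -- restricted to it.
    have hδ : ∀ t : T, (δ.1 ⟨t, hTS t.2⟩ : E) ∈ T := fun t => by
      have := T.add_mem (hp (δ.2.2.2 ⟨t, hTS t.2⟩)) t.2
      simpa using this
    let γ₀ : T →ₗ[F] T := LinearMap.codRestrict T
      (S.subtype ∘ₗ δ.1.toLinearMap ∘ₗ Submodule.inclusion hTS) hδ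
    have hγ₀ : Function.Injective γ₀ := by
      intro t t' h
      have h1 := Subtype.ext_iff.1 h
      have h2 := δ.1.injective (Subtype.ext h1)
      exact Subtype.ext (Subtype.mk.inj h2)
    let γ₁ : T ≃ₗ[F] T := LinearEquiv.ofInjectiveEndo γ₀ hγ₀
    have hγ₁ : ∀ t : T, (γ₁ t : E) = δ.1 ⟨t, hTS t.2⟩ := fun t => rfl
    let γ : Ext .quotient p T := ⟨γ₁, hp, fun x hx hS => δ.2.2.1 x hx (hTS hS),
      fun t => δ.2.2.2 ⟨t, hTS t.2⟩⟩
    -- The defect of `δ` from the standard extension of its restriction. It is the displacement of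
    -- `s` minus the displacement of `π s`, hence takes values in `p.space`.
    let a₀ : S →ₗ[F] E := S.subtype ∘ₗ δ.1.toLinearMap - T.subtype ∘ₗ γ₁.toLinearMap ∘ₗ π -
      (S.subtype - T.subtype ∘ₗ π)
    have ha₀ : ∀ s, a₀ s = δ.1 s - γ₁ (π s) - (s - π s) := fun s => rfl
    let a : vanishing T S p.space := by
      refine ⟨a₀, fun s hs => ?_, fun s => ?_⟩
      · rw [ha₀, hγ₁, show π s = ⟨s, hs⟩ from hπ ⟨s, hs⟩]
        simp
      · rw [ha₀, hγ₁]
        have h1 := δ.2.2.2 s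
        have h2 := δ.2.2.2 ⟨π s, hTS (π s).2⟩
        convert p.space.sub_mem h1 h2 using 1
        abel
    refine ⟨(γ, a), Subtype.ext (LinearEquiv.ext fun s => Subtype.ext ?_)⟩
    change (extendEquiv hTS π hπ γ.1 (vanishingIncl hp a) s : E) = _
    rw [coe_extendEquiv]
    change (γ₁ (π s) : E) + (s - π s) + (δ.1 s - γ₁ (π s) - (s - π s)) = _
    abel

/-- The point is that `η(p.space) + p'.space = T`: decompose `η⁻¹ t` along `p.space + p'.space` and
use that `η` preserves the second summand, where it is `p'.g`. -/
lemma vanishingComb_surjective (hT : p.space ⊔ p'.space = T) (η : Ext .quotient p' T) :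
    Function.Surjective (vanishingComb (S := S) hp hp' η.1) := by
  let L : p.space × p'.space →ₗ[F] T :=
    (η.1.toLinearMap ∘ₗ Submodule.inclusion hp).coprod (Submodule.inclusion hp')
  have hL : ∀ x : p.space × p'.space, (L x : E) = η.1 ⟨x.1, hp x.1.2⟩ + x.2 := fun x => rfl
  have hLs : Function.Surjective L := by
    intro t
    obtain ⟨v, hv, w, hw, h⟩ := Submodule.mem_sup.1
      (show (η.1.symm t : E) ∈ p.space ⊔ p'.space from hT.symm ▸ (η.1.symm t).2)
    refine ⟨(⟨v, hv⟩, p'.g ⟨w, hw⟩), Subtype.ext ?_⟩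
    rw [hL, ← η.2.2.1 w hw (hp' hw), ← Submodule.coe_add, ← _root_.map_add]
    have : (⟨v, hp hv⟩ + ⟨w, hp' hw⟩ : T) = η.1.symm t := Subtype.ext h
    simp [this]
  -- A linear section lifts a whole map `S/T → T` at once, keeping the lifts linear and zero on `T`.
  obtain ⟨σ, hσ⟩ := LinearMap.exists_rightInverse_of_surjective L (LinearMap.range_eq_top.2 hLs)
  intro c
  let c' : S →ₗ[F] T := LinearMap.codRestrict T c.1 c.2.2
  have hc' : ∀ s : S, (s : E) ∈ T → σ (c' s) = 0 := fun s hs => by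
    rw [show c' s = 0 from Subtype.ext (c.2.1 s hs), map_zero]
  refine ⟨(⟨p.space.subtype ∘ₗ LinearMap.fst F _ _ ∘ₗ σ ∘ₗ c', ?_, ?_⟩,
    ⟨p'.space.subtype ∘ₗ LinearMap.snd F _ _ ∘ₗ σ ∘ₗ c', ?_, ?_⟩), ?_⟩
  · intro s hs
    simp [hc' s hs]
  · intro s
    exact (σ (c' s)).1.2
  · intro s hs
    simp [hc' s hs]
  · intro s
    exact (σ (c' s)).2.2
  · refine Subtype.ext (LinearMap.ext fun s => ?_)
    rw [coe_vanishingComb]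
    exact (hL (σ (c' s))).symm.trans (congrArg Subtype.val (LinearMap.congr_fun hσ (c' s)))

/-- Composition law for the torsor coordinates: `a` has values in `T`, so the second map sees it
only through `η`, while `b` kills all the corrections in `T` and depends on `s` alone. -/
lemma extendEquiv_trans (γ η : T ≃ₗ[F] T) (a : vanishing T S p.space)
    (b : vanishing T S p'.space) :
    (extendEquiv hTS π hπ γ (vanishingIncl hp a)).trans
        (extendEquiv hTS π hπ η (vanishingIncl hp' b)) =
      extendEquiv hTS π hπ (γ.trans η) (vanishingComb hp hp' η (a, b)) := by
  ext s
  obtain ⟨y, hy⟩ : ∃ y, y = extendEquiv hTS π hπ γ (vanishingIncl hp a) s := ⟨_, rfl⟩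
  have hyE : (y : E) = γ (π s) + (s - π s) + a.1 s := by
    rw [hy]
    exact coe_extendEquiv hTS π hπ _ _ s
  have hy' : y = ⟨γ (π s), hTS (γ (π s)).2⟩ + (s - ⟨π s, hTS (π s).2⟩) +
      ⟨a.1 s, hTS (hp (a.2.2 s))⟩ := Subtype.ext hyE
  have hπy : π y = γ (π s) + ⟨a.1 s, hp (a.2.2 s)⟩ := by
    rw [hy', _root_.map_add, _root_.map_add, map_sub, hπ, hπ, hπ ⟨a.1 s, hp (a.2.2 s)⟩]
    simp
  have hby : b.1 y = b.1 s := by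
    rw [hy', _root_.map_add, _root_.map_add, map_sub, b.2.1 ⟨_, hTS (γ (π s)).2⟩ (γ (π s)).2,
      b.2.1 ⟨_, hTS (π s).2⟩ (π s).2, b.2.1 ⟨_, hTS (hp (a.2.2 s))⟩ (hp (a.2.2 s))]
    simp
  rw [LinearEquiv.trans_apply, ← hy, coe_extendEquiv, coe_extendEquiv, coe_vanishingComb, hπy, hyE]
  change _ + _ + b.1 y = _
  rw [hby, _root_.map_add]
  simp only [Submodule.coe_add, LinearEquiv.trans_apply]
  abel

variable [Finite E] {M : Type*} [AddCommGroup M] [Module ℂ M]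

/-- Case `p.space = T` of the torsor description: the restriction to `T` is imposed, so only the
linear map `S/T → T` remains. -/
lemma avg_ext_self (g : T ≃ₗ[F] T) (f : (S ≃ₗ[F] S) → M) :
    (avg fun ζ : Ext .quotient (⟨T, g⟩ : PartialAut F E) S => f ζ.1) =
      avg fun c : vanishing T S T => f (extendEquiv hTS π hπ g c) := by
  rw [← avg_equiv (Equiv.ofBijective _
    (chainMap_bijective hTS π hπ (p := ⟨T, g⟩) le_rfl)), avg_prod]
  have : Nonempty (Ext .quotient (⟨T, g⟩ : PartialAut F E) T) :=
    ⟨⟨_, isTrivialOn_self .quotient (⟨T, g⟩ : PartialAut F E)⟩⟩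
  rw [← avg_const (α := Ext .quotient (⟨T, g⟩ : PartialAut F E) T)
    (avg fun c : vanishing T S T => f (extendEquiv hTS π hπ g c))]
  refine avg_congr fun γ => avg_congr fun c => ?_
  change f (extendEquiv hTS π hπ γ.1 (vanishingIncl le_rfl c)) = _
  rw [Ext.eq_self .quotient (⟨T, g⟩ : PartialAut F E) γ]
  rfl

include hTS in
/-- Extending to the sum `T` of the two subspaces, composing and extending to `S` amounts, in mean,
to extending to `S` and composing. -/
lemma avg_ext_chain (hT : p.space ⊔ p'.space = T) (f : (S ≃ₗ[F] S) → M) :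
    (avg fun γ : Ext .quotient p T => avg fun η : Ext .quotient p' T =>
      avg fun ζ : Ext .quotient (⟨T, γ.1.trans η.1⟩ : PartialAut F E) S => f ζ.1) =
    avg fun γ : Ext .quotient p S => avg fun η : Ext .quotient p' S => f (γ.1.trans η.1) := by
  obtain ⟨π, hπ'⟩ := LinearMap.exists_leftInverse_of_injective (Submodule.inclusion hTS)
    (LinearMap.ker_eq_bot.2 (Submodule.inclusion_injective hTS))
  have hπ : ∀ t : T, π ⟨t, hTS t.2⟩ = t := fun t => LinearMap.congr_fun hπ' t
  have hp : p.space ≤ T := hT ▸ le_sup_left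
  have hp' : p'.space ≤ T := hT ▸ le_sup_right
  rw [← avg_equiv (Equiv.ofBijective _ (chainMap_bijective hTS π hπ hp)), avg_prod]
  refine avg_congr fun γ => ?_
  have h1 : ∀ a : vanishing T S p.space,
      (avg fun η : Ext .quotient p' S =>
        f ((Equiv.ofBijective _ (chainMap_bijective hTS π hπ hp) (γ, a)).1.trans η.1)) =
      avg fun η : Ext .quotient p' T => avg fun b : vanishing T S p'.space =>
        f (extendEquiv hTS π hπ (γ.1.trans η.1) (vanishingComb hp hp' η.1 (a, b))) := by
    intro a
    rw [← avg_equiv (Equiv.ofBijective _ (chainMap_bijective hTS π hπ hp')), avg_prod]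
    refine avg_congr fun η => avg_congr fun b => ?_
    rw [← extendEquiv_trans]
    rfl
  -- The combined coordinate depends on `η`, which must be fixed before averaging over `a` and `b`.
  rw [avg_congr h1, avg_comm]
  refine avg_congr fun η => ?_
  -- For uniform `(a, b)` the combined coordinate is uniform among the maps `S/T → T`, by
  -- surjectivity of a group morphism.
  rw [avg_ext_self hTS π hπ, ← avg_addMonoidHom _ (vanishingComb_surjective hp hp' hT η), avg_prod]

/-- The product of partial automorphisms is associative for the quotient notion. -/
lemma mul_assoc_single (p₁ p₂ p₃ : PartialAut F E) :
    mul .quotient (mul .quotient (Finsupp.single p₁ 1) (Finsupp.single p₂ 1))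
        (Finsupp.single p₃ 1) =
      mul .quotient (Finsupp.single p₁ 1)
        (mul .quotient (Finsupp.single p₂ 1) (Finsupp.single p₃ 1)) := by
  obtain ⟨S, hS⟩ : ∃ S, S = p₁.space ⊔ p₂.space ⊔ p₃.space := ⟨_, rfl⟩
  -- The common value of both bracketings: three independent extensions to the total sum.
  trans avg fun γ : Ext .quotient p₁ S => avg fun η : Ext .quotient p₂ S =>
    avg fun κ : Ext .quotient p₃ S => Finsupp.single ⟨S, (γ.1.trans η.1).trans κ.1⟩ (1 : ℂ)
  · rw [mul_single_single]
    simp only [one_smul]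
    rw [basisMul_eq .quotient rfl]
    simp only [map_avg₂, mul_single_single, one_smul]
    have hT : p₁.space ⊔ p₂.space ≤ S := hS ▸ le_sup_left
    have h := avg_ext_chain (p := p₁) (p' := p₂) hT rfl fun ζ =>
        avg fun κ : Ext .quotient p₃ S =>
          Finsupp.single (⟨S, ζ.trans κ.1⟩ : PartialAut F E) (1 : ℂ)
    rw [← h]
    refine avg_congr fun γ => avg_congr fun η => ?_
    exact basisMul_eq .quotient hS.symm
  · rw [mul_single_single .quotient p₂]
    simp only [one_smul]
    rw [basisMul_eq .quotient rfl]
    simp only [map_avg, mul_single_single, one_smul]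
    have hS' : p₁.space ⊔ (p₂.space ⊔ p₃.space) = S := by rw [hS, sup_assoc]
    have hT : p₂.space ⊔ p₃.space ≤ S := hS' ▸ le_sup_right
    have h : ∀ γ : Ext .quotient p₁ S, _ := fun γ => avg_ext_chain (p := p₂) (p' := p₃) hT rfl
      fun ζ => Finsupp.single (⟨S, γ.1.trans ζ⟩ : PartialAut F E) (1 : ℂ)
    have hc : ∀ (η : Ext .quotient p₂ (p₂.space ⊔ p₃.space))
        (κ : Ext .quotient p₃ (p₂.space ⊔ p₃.space)), _ := fun η κ =>
      basisMul_eq .quotient (p := p₁) (p' := ⟨_, η.1.trans κ.1⟩) hS'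
    refine (avg_congr h).symm.trans ?_
    simp only [hc]
    rw [avg_comm]
    refine avg_congr fun η => ?_
    rw [avg_comm]

lemma mul_assoc (x y z : PartialAut F E →₀ ℂ) :
    mul .quotient (mul .quotient x y) z = mul .quotient x (mul .quotient y z) := by
  induction x using Finsupp.induction_linear with
  | zero => simp
  | add x x' hx hx' => simp only [_root_.map_add, LinearMap.add_apply, hx, hx']
  | single p c =>
    induction y using Finsupp.induction_linear with
    | zero => simp
    | add y y' hy hy' => simp only [_root_.map_add, LinearMap.add_apply, hy, hy']
    | single p' c' =>
      induction z using Finsupp.induction_linear with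
      | zero => simp
      | add z z' hz hz' => simp only [_root_.map_add, hz, hz']
      | single p'' c'' =>
        have h := mul_assoc_single p p' p''
        rw [← mul_one c, ← mul_one c', ← mul_one c'', ← smul_eq_mul, ← smul_eq_mul, ← smul_eq_mul,
          ← Finsupp.smul_single, ← Finsupp.smul_single, ← Finsupp.smul_single]
        simp only [_root_.map_smul, LinearMap.smul_apply, h]

end Associativity

end PartialAut

/-! ### From partial isomorphisms to partial automorphisms: orbits and extensions -/

namespace PartialIso

variable {F E E' : Type*} [Field F] [AddCommGroup E] [Module F E] [AddCommGroup E'] [Module F E']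

/-- The partial automorphism `g₂ ∘ g₁` of the left subspace. -/
def toAut (G : PartialIso F E) : PartialAut F E := ⟨G.left, G.g₁.trans G.g₂⟩

/-- Exchange of the two subspaces of a partial isomorphism. -/
def symm (G : PartialIso F E) : PartialIso F E := ⟨G.right, G.left, G.g₂, G.g₁⟩

lemma iso_toAut_symm (G : PartialIso F E) : PartialAut.Iso G.toAut G.symm.toAut :=
  ⟨G.g₁, fun _ => rfl⟩

lemma toAut_map (ι : E' →ₗ[F] E) (hι : Function.Injective ι) (G : PartialIso F E') :
    (map ι hι G).toAut = PartialAut.map ι hι G.toAut := by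
  refine PartialAut.eq_map ι hι rfl ?_
  intro x hx hx'
  have h1 : (map ι hι G).g₁ ⟨ι x, hx'⟩ = ⟨ι (G.g₁ ⟨x, hx⟩), ⟨_, (G.g₁ ⟨x, hx⟩).2, rfl⟩⟩ :=
    Subtype.ext (map_g₁ ι hι G x hx hx')
  change ((map ι hι G).g₂ ((map ι hι G).g₁ ⟨ι x, hx'⟩) : E) = _
  rw [h1]
  exact map_g₂ ι hι G _ _ _

lemma toAut_transport (a b : E ≃ₗ[F] E) (G : PartialIso F E) :
    (transport a b G).toAut = PartialAut.map (a : E →ₗ[F] E) a.injective G.toAut := by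
  refine PartialAut.eq_map _ _ rfl ?_
  intro x hx hx'
  have h1 : (transport a b G).g₁ ⟨a x, hx'⟩ = ⟨b (G.g₁ ⟨x, hx⟩), ⟨_, (G.g₁ ⟨x, hx⟩).2, rfl⟩⟩ :=
    Subtype.ext (transport_g₁ a b G x hx hx')
  change ((transport a b G).g₂ ((transport a b G).g₁ ⟨a x, hx'⟩) : E) = _
  rw [h1]
  exact transport_g₂ a b G _ _ _

lemma iso_transport (a b : E ≃ₗ[F] E) (G : PartialIso F E) :
    PartialAut.Iso G.toAut (transport a b G).toAut := by
  rw [toAut_transport]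
  exact PartialAut.iso_map _ _ _

/-- Two partial isomorphisms with isomorphic automorphisms `g₂ ∘ g₁` are in the same orbit. -/
lemma exists_transport_eq [FiniteDimensional F E] {G H : PartialIso F E}
    (h : PartialAut.Iso G.toAut H.toAut) : ∃ a b : E ≃ₗ[F] E, transport a b G = H := by
  obtain ⟨φ, hφ⟩ := h
  change G.left ≃ₗ[F] H.left at φ
  replace hφ : ∀ x, φ (G.g₂ (G.g₁ x)) = H.g₂ (H.g₁ (φ x)) := hφ
  -- The choice forced by compatibility with `g₁`; compatibility with `g₂` is then the hypothesis on
  -- `φ`. The two sides of the action are independent, so `φ` and `ψ` may be extended separately to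
  -- `E`.
  let ψ : G.right ≃ₗ[F] H.right := (G.g₁.symm.trans φ).trans H.g₁
  have hψ : ∀ x, ψ (G.g₁ x) = H.g₁ (φ x) := fun x => by simp [ψ]
  have hψ' : ∀ y, φ (G.g₂ y) = H.g₂ (ψ y) := fun y => by
    obtain ⟨x, rfl⟩ := G.g₁.surjective y
    rw [hφ, hψ]
  obtain ⟨a, ha⟩ := Submodule.exists_linearEquiv_restrict_eq φ
  obtain ⟨b, hb⟩ := Submodule.exists_linearEquiv_restrict_eq ψ
  have hmap : ∀ {V W : Submodule F E} (χ : V ≃ₗ[F] W) (c : E ≃ₗ[F] E) (_ : ∀ x : V, χ x = c x),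
      W = V.map (c : E →ₗ[F] E) := by
    intro V W χ c hc
    ext y
    constructor
    · intro hy
      exact ⟨χ.symm ⟨y, hy⟩, (χ.symm ⟨y, hy⟩).2, by simpa using (hc (χ.symm ⟨y, hy⟩)).symm⟩
    · rintro ⟨x, hx, rfl⟩
      change c x ∈ _
      rw [← hc ⟨x, hx⟩]
      exact (χ _).2
  refine ⟨a, b, (eq_transport a b G (hmap φ a ha) (hmap ψ b hb) ?_ ?_).symm⟩
  · intro x hx hx'
    have : (⟨a x, hx'⟩ : H.left) = φ ⟨x, hx⟩ := Subtype.ext (ha ⟨x, hx⟩).symm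
    rw [this, ← hψ]
    exact hb _
  · intro x hx hx'
    have : (⟨b x, hx'⟩ : H.right) = ψ ⟨x, hx⟩ := Subtype.ext (hb ⟨x, hx⟩).symm
    rw [this, ← hψ']
    exact ha _

section Extensions

variable (τ : TrivialityNotion)

lemma IsTrivialExtension.isExtension {τ : TrivialityNotion} {G G' : PartialIso F E}
    (h : IsTrivialExtension τ G G') : IsExtension G G' := by
  cases τ <;> exact h.1

lemma IsExtension.symm {G G' : PartialIso F E} (h : IsExtension G G') :
    IsExtension G.symm G'.symm := by
  obtain ⟨hl, hr, h₁, h₂⟩ := h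
  exact ⟨hr, hl, h₂, h₁⟩

lemma IsTrivialExtension.symm {τ : TrivialityNotion} {G G' : PartialIso F E}
    (h : IsTrivialExtension τ G G') : IsTrivialExtension τ G.symm G'.symm := by
  cases τ with
  | split =>
    obtain ⟨he, A, B, ψ, hA, hB, h1, h2, h3, h4⟩ := h
    exact ⟨he.symm, B, A, ψ.symm, hB, hA, h2, h1, h4, h3⟩
  | quotient =>
    obtain ⟨⟨hl, hr, h₁, h₂⟩, h⟩ := h
    refine ⟨⟨hr, hl, h₂, h₁⟩, fun y => ?_⟩
    change (G'.g₁ (G'.g₂ y) : E) - y ∈ G.right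
    obtain ⟨x, rfl⟩ := G'.g₁.surjective y
    -- For `y = g₁⁺ x`, the difference `g₁⁺ g₂⁺ y - y` is `g₁⁺` of `g₂⁺ g₁⁺ x - x`, an element of
    -- `V`, and `g₁⁺` sends `V` to `W`.
    have := h₁ ⟨_, h x⟩
    have h' : Submodule.inclusion hl ⟨_, h x⟩ = G'.g₂ (G'.g₁ x) - x := rfl
    rw [h', map_sub, Submodule.coe_sub] at this
    rw [this]
    exact (G.g₁ _).2

/-- A trivial extension is an extension for which `g₁ ∘ g₂` is a trivial extension. -/
lemma isTrivialExtension_iff {G G' : PartialIso F E} :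
    IsTrivialExtension τ G G' ↔
      IsExtension G G' ∧ PartialAut.IsTrivialOn τ G.symm.toAut G'.symm.toAut.g := by
  constructor
  · intro h
    obtain ⟨hl, hr, h₁, h₂⟩ := h.isExtension
    refine ⟨h.isExtension, hr, fun y hy hy' => ?_, ?_⟩
    · have h3 : G'.g₂ ⟨y, hy'⟩ = Submodule.inclusion hl (G.g₂ ⟨y, hy⟩) :=
        Subtype.ext (h₂ ⟨y, hy⟩)
      change (G'.g₁ (G'.g₂ ⟨y, hy'⟩) : E) = _
      rw [h3, h₁]
      rfl
    · cases τ with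
      | split =>
        obtain ⟨-, A, B, ψ, hA, hB, -, h2, h3, h4⟩ := h
        refine ⟨B, hB, h2.1, h2.2, fun x hx hS => ?_⟩
        have h5 : G'.g₂ ⟨x, hS⟩ = Submodule.inclusion hA (ψ.symm ⟨x, hx⟩) :=
          Subtype.ext (h4 ⟨x, hx⟩)
        change (G'.g₁ (G'.g₂ ⟨x, hS⟩) : E) = _
        rw [h5, h3]
        simp
      | quotient => exact h.symm.2
  · rintro ⟨he, -, -, h⟩
    cases τ with
    | split =>
      refine ⟨he, ?_⟩
      obtain ⟨hl, hr, h₁, h₂⟩ := he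
      obtain ⟨B, hB, hd, hs, h⟩ := h
      replace hB : B ≤ G'.right := hB
      replace hd : Disjoint G.right B := hd
      replace hs : G.right ⊔ B = G'.right := hs
      replace h : ∀ x ∈ B, ∀ hS : x ∈ G'.right, (G'.g₁ (G'.g₂ ⟨x, hS⟩) : E) = x := h
      -- The left complement `A` has to be the image of `B` under `g₂⁺`; `j` carries the
      -- decomposition of the right subspace to the left one, and `ψ` is the inverse of its
      -- restriction to `B`.
      let j : G'.right →ₗ[F] E := G'.left.subtype ∘ₗ G'.g₂.toLinearMap
      have hj : Function.Injective j := Subtype.val_injective.comp G'.g₂.injective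
      have hjr : ∀ V ≤ G'.right, ((V.submoduleOf G'.right).map G'.right.subtype) = V :=
        fun V hV => by rw [Submodule.submoduleOf, Submodule.map_comap_subtype, inf_eq_right.2 hV]
      have hleft : (G.right.submoduleOf G'.right).map j = G.left := by
        ext x
        constructor
        · rintro ⟨y, hy, rfl⟩
          have : j y = G.g₂ ⟨y, hy⟩ := h₂ ⟨y, hy⟩
          rw [this]
          exact (G.g₂ _).2
        · intro hx
          obtain ⟨y, hy⟩ := G.g₂.surjective ⟨x, hx⟩
          refine ⟨⟨y, hr y.2⟩, y.2, ?_⟩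
          exact (h₂ y).trans (congrArg Subtype.val hy)
      have hdis : Disjoint (G.right.submoduleOf G'.right) (B.submoduleOf G'.right) := by
        rw [Submodule.disjoint_def] at hd ⊢
        intro x hx hx'
        exact Subtype.ext (hd x hx hx')
      have hsup : G.right.submoduleOf G'.right ⊔ B.submoduleOf G'.right = ⊤ := by
        apply Submodule.map_injective_of_injective G'.right.injective_subtype
        rw [Submodule.map_sup, hjr _ hr, hjr _ hB, hs, Submodule.map_top, Submodule.range_subtype]
      let e := (Submodule.submoduleOfEquivOfLe hB).symm.trans
        (Submodule.equivMapOfInjective j hj (B.submoduleOf G'.right))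
      have hee : ∀ b : B, (e b : E) = G'.g₂ ⟨b, hB b.2⟩ := fun b => rfl
      refine ⟨(B.submoduleOf G'.right).map j, B, e.symm, ?_, hB, ⟨?_, ?_⟩, ⟨hd, hs⟩, ?_, ?_⟩
      · rintro _ ⟨y, hy, rfl⟩
        exact (G'.g₂ y).2
      · rw [← hleft]
        exact Submodule.disjoint_map hj hdis
      · rw [← hleft, ← Submodule.map_sup, hsup, Submodule.map_top]
        ext x
        constructor
        · rintro ⟨y, rfl⟩
          exact (G'.g₂ y).2
        · intro hx
          exact ⟨G'.g₂.symm ⟨x, hx⟩, by simp [j]⟩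
      · intro a
        obtain ⟨b, rfl⟩ := e.surjective a
        rw [LinearEquiv.symm_apply_apply, ← h b b.2 (hB b.2)]
        rfl
      · intro b
        rfl
    | quotient =>
      have := IsTrivialExtension.symm (τ := .quotient) (G := G.symm) (G' := G'.symm) ⟨he.symm, h⟩
      exact this

variable {Z : Submodule F E}

/-- The automorphism `g₁ ∘ g₂` of the right subspace of an extension. -/
def rightAut {G : PartialIso F E} (G' : RightExt τ G Z) : Z ≃ₗ[F] Z :=
  (LinearEquiv.ofEq _ _ G'.2.2.symm).trans
    ((G'.1.g₂.trans G'.1.g₁).trans (LinearEquiv.ofEq _ _ G'.2.2))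

/-- Injective extensions of `g₂` to `Z`. -/
abbrev InjExt (G : PartialIso F E) (Z : Submodule F E) : Type _ :=
  {a : Z →ₗ[F] E // Function.Injective a ∧
    ∀ y (hy : y ∈ G.right) (hZ : y ∈ Z), a ⟨y, hZ⟩ = G.g₂ ⟨y, hy⟩}

/-- The partial isomorphism `(range a | γ ∘ a⁻¹ ⇄ a | Z)`. -/
noncomputable def ofInjective (a : Z →ₗ[F] E) (ha : Function.Injective a) (γ : Z ≃ₗ[F] Z) :
    PartialIso F E where
  left := LinearMap.range a
  right := Z
  g₁ := (LinearEquiv.ofInjective a ha).symm.trans γ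
  g₂ := LinearEquiv.ofInjective a ha

lemma ofInjective_g₁ (a : Z →ₗ[F] E) (ha : Function.Injective a) (γ : Z ≃ₗ[F] Z) (z : Z)
    (hz : a z ∈ LinearMap.range a) : (ofInjective a ha γ).g₁ ⟨a z, hz⟩ = γ z := by
  change γ ((LinearEquiv.ofInjective a ha).symm (LinearEquiv.ofInjective a ha z)) = _
  rw [LinearEquiv.symm_apply_apply]

lemma isTrivialExtension_ofInjective {G : PartialIso F E} (a : InjExt G Z)
    (γ : PartialAut.Ext τ G.symm.toAut Z) :
    IsTrivialExtension τ G (ofInjective a.1 a.2.1 γ.1) := by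
  have hval : ∀ z, (ofInjective a.1 a.2.1 γ.1).symm.toAut.g z = γ.1 z := fun z =>
    ofInjective_g₁ a.1 a.2.1 γ.1 z ⟨z, rfl⟩
  rw [isTrivialExtension_iff]
  constructor
  · have hr : G.right ≤ Z := γ.2.1
    have ha : ∀ y : G.right, a.1 ⟨y, hr y.2⟩ = G.g₂ y := fun y => a.2.2 y y.2 _
    refine ⟨fun x hx => ?_, hr, fun x => ?_, fun y => ha y⟩
    · obtain ⟨y, hy⟩ := G.g₂.surjective ⟨x, hx⟩
      exact ⟨⟨y, hr y.2⟩, (ha y).trans (congrArg Subtype.val hy)⟩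
    · obtain ⟨y, rfl⟩ := G.g₂.surjective x
      have h1 := ofInjective_g₁ a.1 a.2.1 γ.1 ⟨y, hr y.2⟩ ⟨_, rfl⟩
      have h2 := γ.2.2.1 y y.2 (hr y.2)
      refine Eq.trans ?_ h2
      rw [← h1]
      congr 2
      exact Subtype.ext (ha y).symm
  · have h : (ofInjective a.1 a.2.1 γ.1).symm.toAut.g = γ.1 := LinearEquiv.ext hval
    exact (congrArg (PartialAut.IsTrivialOn τ G.symm.toAut (S := Z)) h).mpr γ.2

/-- The extension of `G` given by an extension of `g₂` and an extension of `g₁ ∘ g₂`. -/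
noncomputable def rightExtMap (G : PartialIso F E)
    (x : PartialAut.Ext τ G.symm.toAut Z × InjExt G Z) : RightExt τ G Z :=
  ⟨ofInjective x.2.1 x.2.2.1 x.1.1, isTrivialExtension_ofInjective τ x.2 x.1, rfl⟩

/-- An extension is recovered from `g₂⁺` and `g₁⁺ ∘ g₂⁺`. Triviality constrains only the latter, so
the two data are independent. -/
lemma rightExtMap_bijective (G : PartialIso F E) :
    Function.Bijective (rightExtMap τ (Z := Z) G) := by
  constructor
  · rintro ⟨γ, a⟩ ⟨γ', a'⟩ h
    have h0 := congrArg Subtype.val h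
    have ha : a = a' := by
      refine Subtype.ext (LinearMap.ext fun z => ?_)
      exact g₂_congr h0 z z.2
    subst ha
    refine Prod.ext (Subtype.ext (LinearEquiv.ext fun z => Subtype.ext ?_)) rfl
    have h1 := g₁_congr h0 (a.1 z) ⟨z, rfl⟩
    refine Eq.trans (congrArg Subtype.val (ofInjective_g₁ a.1 a.2.1 γ.1 z ⟨z, rfl⟩)).symm
      (h1.trans (congrArg Subtype.val (ofInjective_g₁ a.1 a.2.1 γ'.1 z ⟨z, rfl⟩)))
  · rintro ⟨G', hG', rfl⟩
    obtain ⟨⟨hl, hr, h₁, h₂⟩, h⟩ := (isTrivialExtension_iff τ).1 hG'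
    let a : G'.right →ₗ[F] E := G'.left.subtype ∘ₗ G'.g₂.toLinearMap
    have ha : Function.Injective a := Subtype.val_injective.comp G'.g₂.injective
    refine ⟨(⟨G'.symm.toAut.g, h⟩, ⟨a, ha, fun y hy hZ => h₂ ⟨y, hy⟩⟩), Subtype.ext ?_⟩
    refine ext_of_values ?_ rfl ?_ fun _ _ _ => rfl
    · ext x
      constructor
      · rintro ⟨y, rfl⟩
        exact (G'.g₂ y).2
      · intro hx
        exact ⟨G'.g₂.symm ⟨x, hx⟩, by simp [a]⟩
    · rintro _ ⟨y, rfl⟩ hx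
      refine (congrArg Subtype.val (ofInjective_g₁ a ha G'.symm.toAut.g y ⟨y, rfl⟩)).trans ?_
      rfl

/-- The round trip starting from the far left subspace is conjugated by `G'.1.g₂` into a round trip
starting from the middle space `Z`, left side first. -/
lemma iso_comp {G H : PartialIso F E} (G' : RightExt τ G Z) (H' : RightExt τ H.symm Z)
    (h : G'.1.right = H'.1.symm.left) :
    PartialAut.Iso (⟨Z, (rightAut τ G').trans (rightAut τ H')⟩ : PartialAut F E)
      (comp G'.1 H'.1.symm h).toAut := by
  obtain ⟨G', hG', rfl⟩ := G'
  obtain ⟨⟨l, r, g₁, g₂⟩, hH', hr⟩ := H'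
  change r = G'.right at hr
  subst hr
  exact ⟨G'.g₂, fun x => rfl⟩

variable [Finite E]

/-- The choice of an injective extension of `g₂` is independent of the automorphism of `Z`, so
averaging over it has no effect. -/
lemma avg_rightExt {M : Type*} [AddCommGroup M] [Module ℂ M] (G : PartialIso F E)
    (f : (Z ≃ₗ[F] Z) → M) :
    (avg fun G' : RightExt τ G Z => f (rightAut τ G')) =
      avg fun γ : PartialAut.Ext τ G.symm.toAut Z => f γ.1 := by
  have : FiniteDimensional F E := Module.Finite.of_finite
  have : Finite (Z →ₗ[F] E) := DFunLike.finite _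
  have : Fintype (InjExt G Z) := Fintype.ofFinite _
  have : Nonempty (InjExt G Z) := by
    -- Extending `g₂` to an automorphism of `E` and restricting to `Z` shows that injective
    -- extensions exist, as needed for the mean of a constant.
    obtain ⟨b, hb⟩ := Submodule.exists_linearEquiv_restrict_eq G.g₂
    exact ⟨⟨(b : E →ₗ[F] E) ∘ₗ Z.subtype, b.injective.comp Subtype.val_injective,
      fun y hy _ => (hb ⟨y, hy⟩).symm⟩⟩
  rw [← avg_equiv (Equiv.ofBijective _ (rightExtMap_bijective τ G)), avg_prod]
  refine avg_congr fun γ => ?_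
  refine Eq.trans (avg_congr fun a => ?_) (avg_const (α := InjExt G Z) (f γ.1))
  congr 1
  exact LinearEquiv.ext fun z => ofInjective_g₁ a.1 a.2.1 γ.1 z ⟨z, rfl⟩

/-- Extensions with fixed left subspace are extensions with fixed right subspace of the
partial isomorphism read backwards. -/
def leftExtEquiv (H : PartialIso F E) (Z : Submodule F E) :
    LeftExt τ H Z ≃ RightExt τ H.symm Z where
  toFun H' := ⟨H'.1.symm, H'.2.1.symm, H'.2.2⟩
  invFun H' := ⟨H'.1.symm, H'.2.1.symm, H'.2.2⟩
  left_inv _ := rfl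
  right_inv _ := rfl

lemma conjMean_comp (G H : PartialIso F E) :
    (avg fun G' : RightExt τ G Z => avg fun H' : LeftExt τ H Z =>
      PartialAut.conjMean F E (Finsupp.single
        (comp G'.1 H'.1 (G'.2.2.trans H'.2.2.symm)).toAut (1 : ℂ))) =
    PartialAut.conjMean F E (PartialAut.mulOn τ G.symm.toAut H.toAut Z) := by
  simp only [PartialAut.mulOn, map_avg]
  rw [← avg_rightExt τ G fun γ => avg fun η : PartialAut.Ext τ H.toAut Z =>
      PartialAut.conjMean F E (Finsupp.single (⟨Z, γ.trans η.1⟩ : PartialAut F E) (1 : ℂ))]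
  refine avg_congr fun G' => ?_
  refine Eq.trans ?_ (avg_rightExt τ H.symm fun η => PartialAut.conjMean F E
    (Finsupp.single (⟨Z, (rightAut τ G').trans η⟩ : PartialAut F E) (1 : ℂ)))
  rw [← avg_equiv (leftExtEquiv τ H Z).symm]
  refine avg_congr fun H' => ?_
  exact (iso_comp τ G' H' _).symm.conjMean_eq 1

end Extensions

end PartialIso

/-! ### The product seen on partial automorphisms -/

section Algebra

variable {F : Type*} [Field F] (τ : TrivialityNotion) {n : ℕ}

lemma basisMul_eq_avg [Finite F] {G H : PartialIso F (Fin n → F)} {Z : Submodule F (Fin n → F)}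
    (h : G.right ⊔ H.left = Z) :
    basisMul τ G H = avg fun G' : PartialIso.RightExt τ G Z =>
      avg fun H' : PartialIso.LeftExt τ H Z =>
        Finsupp.single (PartialIso.comp G'.1 H'.1 (G'.2.2.trans H'.2.2.symm)) (1 : ℂ) := by
  subst h
  simp only [basisMul, avg, ← Finset.smul_sum, smul_smul, mul_inv]

variable (F n) in
/-- The linear map sending a partial isomorphism to its automorphism `g₂ ∘ g₁`. -/
noncomputable def toAutLin : PIAlg F n →ₗ[ℂ] (PartialAut F (Fin n → F) →₀ ℂ) :=
  Finsupp.lmapDomain ℂ ℂ PartialIso.toAut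

lemma toAutLin_single (G : PartialIso F (Fin n → F)) (c : ℂ) :
    toAutLin F n (Finsupp.single G c) = Finsupp.single G.toAut c := by
  rw [toAutLin, Finsupp.lmapDomain_apply, Finsupp.mapDomain_single]

/-- The factors meet in the right subspace of `G` and the left subspace of `H`, which is why the
first one enters through `g₁ ∘ g₂`. -/
lemma conjMean_toAutLin_basisMul [Finite F] (G H : PartialIso F (Fin n → F)) :
    PartialAut.conjMean F _ (toAutLin F n (basisMul τ G H)) =
      PartialAut.conjMean F _ (PartialAut.basisMul τ G.symm.toAut H.toAut) := by
  have h := PartialIso.conjMean_comp τ (Z := G.right ⊔ H.left) G H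
  rw [basisMul_eq_avg τ rfl]
  refine Eq.trans ?_ h
  simp only [map_avg, toAutLin_single]

end Algebra

/-! ### Equivariance of extensions and compositions -/

namespace PartialIso

variable {F E : Type*} [Field F] [AddCommGroup E] [Module F E]

lemma IsExtension.transport {G G' : PartialIso F E} (h : IsExtension G G') (a b : E ≃ₗ[F] E) :
    IsExtension (transport a b G) (transport a b G') := by
  obtain ⟨hl, hr, h₁, h₂⟩ := h
  refine ⟨Submodule.map_mono hl, Submodule.map_mono hr, ?_, ?_⟩
  · rintro ⟨_, x, hx, rfl⟩
    refine (transport_g₁ a b G' x (hl hx) _).trans ?_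
    refine Eq.trans (congrArg b (h₁ ⟨x, hx⟩)) ?_
    exact (transport_g₁ a b G x hx _).symm
  · rintro ⟨_, x, hx, rfl⟩
    refine (transport_g₂ a b G' x (hr hx) _).trans ?_
    refine Eq.trans (congrArg a (h₂ ⟨x, hx⟩)) ?_
    exact (transport_g₂ a b G x hx _).symm

lemma symm_transport (a b : E ≃ₗ[F] E) (G : PartialIso F E) :
    (transport a b G).symm = transport b a G.symm := rfl

lemma IsTrivialExtension.transport {τ : TrivialityNotion} {G G' : PartialIso F E}
    (h : IsTrivialExtension τ G G') (a b : E ≃ₗ[F] E) :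
    IsTrivialExtension τ (transport a b G) (transport a b G') := by
  rw [isTrivialExtension_iff] at h ⊢
  refine ⟨h.1.transport a b, ?_⟩
  have h' : PartialAut.IsTrivialOn τ (PartialAut.map (b : E →ₗ[F] E) b.injective G.symm.toAut)
      (PartialAut.map (b : E →ₗ[F] E) b.injective G'.symm.toAut).g :=
    (PartialAut.isTrivialOn_mapEquiv τ _ _ _ _).1 h.2
  rw [symm_transport, symm_transport, toAut_transport, toAut_transport]
  exact h'

variable (τ : TrivialityNotion) (a b : E ≃ₗ[F] E) (G H : PartialIso F E) (Z : Submodule F E)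

/-- Right extensions are transported by automorphisms acting on the left subspace. -/
def rightExtTransport :
    RightExt τ G Z ≃ RightExt τ (transport a (LinearEquiv.refl F E) G) Z where
  toFun G' := ⟨transport a (LinearEquiv.refl F E) G'.1, G'.2.1.transport a _,
    (Submodule.map_id _).trans G'.2.2⟩
  invFun G' := ⟨transport a.symm (LinearEquiv.refl F E) G'.1, by
    have h := G'.2.1.transport a.symm (LinearEquiv.refl F E)
    have h0 : transport a.symm (LinearEquiv.refl F E) (transport a (LinearEquiv.refl F E) G) = G :=
      transport_symm_transport a (LinearEquiv.refl F E) G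
    rwa [h0] at h,
    (Submodule.map_id _).trans G'.2.2⟩
  left_inv G' := Subtype.ext (transport_symm_transport a (LinearEquiv.refl F E) G'.1)
  right_inv G' := Subtype.ext (transport_transport_symm a (LinearEquiv.refl F E) G'.1)

/-- Left extensions are transported by automorphisms acting on the right subspace. -/
def leftExtTransport :
    LeftExt τ H Z ≃ LeftExt τ (transport (LinearEquiv.refl F E) b H) Z where
  toFun H' := ⟨transport (LinearEquiv.refl F E) b H'.1, H'.2.1.transport _ b,
    (Submodule.map_id _).trans H'.2.2⟩
  invFun H' := ⟨transport (LinearEquiv.refl F E) b.symm H'.1, by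
    have h := H'.2.1.transport (LinearEquiv.refl F E) b.symm
    have h0 : transport (LinearEquiv.refl F E) b.symm (transport (LinearEquiv.refl F E) b H) = H :=
      transport_symm_transport (LinearEquiv.refl F E) b H
    rwa [h0] at h,
    (Submodule.map_id _).trans H'.2.2⟩
  left_inv H' := Subtype.ext (transport_symm_transport (LinearEquiv.refl F E) b H'.1)
  right_inv H' := Subtype.ext (transport_transport_symm (LinearEquiv.refl F E) b H'.1)

lemma comp_transport (h : G.right = H.left)
    (h' : (transport a (LinearEquiv.refl F E) G).right =
      (transport (LinearEquiv.refl F E) b H).left) :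
    comp (transport a (LinearEquiv.refl F E) G) (transport (LinearEquiv.refl F E) b H) h' =
      transport a b (comp G H h) := by
  obtain ⟨U, V, g₁, g₂⟩ := G
  obtain ⟨W, X, h₁, h₂⟩ := H
  obtain rfl : V = W := h
  refine eq_transport a b _ rfl rfl ?_ ?_
  · intro x hx hx'
    have h1 : LinearEquiv.ofEq _ _ h'
        ((transport a (LinearEquiv.refl F E) ⟨U, V, g₁, g₂⟩).g₁ ⟨a x, hx'⟩) =
        ⟨g₁ ⟨x, hx⟩, ⟨_, (g₁ ⟨x, hx⟩).2, rfl⟩⟩ :=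
      Subtype.ext (transport_g₁ a (LinearEquiv.refl F E) ⟨U, V, g₁, g₂⟩ x hx hx')
    change ((transport (LinearEquiv.refl F E) b ⟨V, X, h₁, h₂⟩).g₁ (LinearEquiv.ofEq _ _ h'
        ((transport a (LinearEquiv.refl F E) ⟨U, V, g₁, g₂⟩).g₁ ⟨a x, hx'⟩)) : E) = _
    rw [h1]
    exact transport_g₁ (LinearEquiv.refl F E) b ⟨V, X, h₁, h₂⟩ _ (g₁ ⟨x, hx⟩).2 _
  · intro x hx hx'
    have h1 : LinearEquiv.ofEq _ _ h'.symm
        ((transport (LinearEquiv.refl F E) b ⟨V, X, h₁, h₂⟩).g₂ ⟨b x, hx'⟩) =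
        ⟨h₂ ⟨x, hx⟩, ⟨_, (h₂ ⟨x, hx⟩).2, rfl⟩⟩ :=
      Subtype.ext (transport_g₂ (LinearEquiv.refl F E) b ⟨V, X, h₁, h₂⟩ x hx hx')
    change ((transport a (LinearEquiv.refl F E) ⟨U, V, g₁, g₂⟩).g₂ (LinearEquiv.ofEq _ _ h'.symm
        ((transport (LinearEquiv.refl F E) b ⟨V, X, h₁, h₂⟩).g₂ ⟨b x, hx'⟩)) : E) = _
    rw [h1]
    exact transport_g₂ a (LinearEquiv.refl F E) ⟨U, V, g₁, g₂⟩ _ (h₂ ⟨x, hx⟩).2 _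

end PartialIso

/-! ### Invariant elements as class functions, and multiplicativity of `toAutLin` -/

section Invariants

variable {F : Type*} [Field F] {n : ℕ}

lemma mem_invariants_iff_transport {x : PIAlg F n} :
    x ∈ invariants F n ↔ ∀ a b : (Fin n → F) ≃ₗ[F] (Fin n → F),
      Finsupp.mapDomain (PartialIso.transport a b) x = x :=
  ⟨fun h a b => h a.symm b.symm, fun h k l => h k.symm l.symm⟩

lemma mem_invariants_iff {x : PIAlg F n} :
    x ∈ invariants F n ↔ ∀ G H : PartialIso F (Fin n → F),
      PartialAut.Iso G.toAut H.toAut → x G = x H := by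
  rw [mem_invariants_iff_transport]
  constructor
  · intro h G H hGH
    obtain ⟨a, b, rfl⟩ := PartialIso.exists_transport_eq hGH
    conv_rhs => rw [← h a b]
    rw [Finsupp.mapDomain_apply (PartialIso.transport_injective a b)]
  · intro h a b
    ext G
    rw [← PartialIso.transport_transport_symm a b G,
      Finsupp.mapDomain_apply (PartialIso.transport_injective a b)]
    exact h _ _ (PartialIso.iso_transport _ _ _)

/-- The automorphisms `g₂ ∘ g₁` and `g₁ ∘ g₂` are conjugate by `g₁`, so reading backwards stays in
the same orbit. -/
lemma mapDomain_symm_of_mem {x : PIAlg F n} (hx : x ∈ invariants F n) :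
    Finsupp.mapDomain PartialIso.symm x = x := by
  have hs : Function.Injective (PartialIso.symm : PartialIso F (Fin n → F) → _) :=
    Function.LeftInverse.injective (g := PartialIso.symm) fun G => rfl
  ext G
  rw [show G = G.symm.symm from rfl, Finsupp.mapDomain_apply hs]
  exact mem_invariants_iff.1 hx _ _ (PartialIso.iso_toAut_symm _)

lemma conjMap_toAutLin {x : PIAlg F n} (hx : x ∈ invariants F n)
    (a : (Fin n → F) ≃ₗ[F] (Fin n → F)) :
    PartialAut.conjMap a (toAutLin F n x) = toAutLin F n x := by
  conv_rhs => rw [← mem_invariants_iff_transport.1 hx a (LinearEquiv.refl F _)]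
  simp only [PartialAut.conjMap, toAutLin, Finsupp.lmapDomain_apply, ← Finsupp.mapDomain_comp]
  exact congrArg (Finsupp.mapDomain · x)
    (funext fun G => (PartialIso.toAut_transport a (LinearEquiv.refl F _) G).symm)

variable [Finite F] (τ : TrivialityNotion)

lemma pmul_single_single (G H : PartialIso F (Fin n → F)) (c d : ℂ) :
    pmul τ (Finsupp.single G c) (Finsupp.single H d) = c • d • basisMul τ G H := by
  simp [pmul]

/-- The left action touches only the outer subspace of the first factor, the right action only that
of the second; the sum in the middle is unchanged. -/
lemma mapDomain_transport_basisMul (a b : (Fin n → F) ≃ₗ[F] (Fin n → F))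
    (G H : PartialIso F (Fin n → F)) :
    Finsupp.lmapDomain ℂ ℂ (PartialIso.transport a b) (basisMul τ G H) =
      basisMul τ (PartialIso.transport a (LinearEquiv.refl F _) G)
        (PartialIso.transport (LinearEquiv.refl F _) b H) := by
  have h : (PartialIso.transport a (LinearEquiv.refl F _) G).right ⊔
      (PartialIso.transport (LinearEquiv.refl F _) b H).left = G.right ⊔ H.left :=
    congrArg₂ _ (Submodule.map_id _) (Submodule.map_id _)
  rw [basisMul_eq_avg τ rfl, basisMul_eq_avg τ h,
    ← avg_equiv (PartialIso.rightExtTransport τ a G (G.right ⊔ H.left))]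
  rw [map_avg]
  refine avg_congr fun G' => ?_
  rw [map_avg, ← avg_equiv (PartialIso.leftExtTransport τ b H (G.right ⊔ H.left))]
  refine avg_congr fun H' => ?_
  rw [Finsupp.lmapDomain_apply, Finsupp.mapDomain_single]
  exact congrArg (Finsupp.single · 1) (PartialIso.comp_transport a b G'.1 H'.1 _ _).symm

lemma mapDomain_transport_pmul (a b : (Fin n → F) ≃ₗ[F] (Fin n → F)) (x y : PIAlg F n) :
    Finsupp.lmapDomain ℂ ℂ (PartialIso.transport a b) (pmul τ x y) =
      pmul τ (Finsupp.lmapDomain ℂ ℂ (PartialIso.transport a (LinearEquiv.refl F _)) x)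
        (Finsupp.lmapDomain ℂ ℂ (PartialIso.transport (LinearEquiv.refl F _) b) y) := by
  induction x using Finsupp.induction_linear with
  | zero => simp
  | add x x' hx hx' => simp only [map_add, LinearMap.add_apply, hx, hx']
  | single G c =>
    induction y using Finsupp.induction_linear with
    | zero => simp
    | add y y' hy hy' => simp only [map_add, hy, hy']
    | single H d =>
      simp only [pmul_single_single, map_smul, mapDomain_transport_basisMul]
      rw [Finsupp.lmapDomain_apply, Finsupp.lmapDomain_apply, Finsupp.mapDomain_single,
        Finsupp.mapDomain_single, pmul_single_single]

lemma pmul_mem_invariants {x y : PIAlg F n} (hx : x ∈ invariants F n) (hy : y ∈ invariants F n) :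
    pmul τ x y ∈ invariants F n := by
  rw [mem_invariants_iff_transport] at *
  intro a b
  have h := mapDomain_transport_pmul τ a b x y
  simp only [Finsupp.lmapDomain_apply] at h
  rw [h, hx, hy]

lemma conjMean_toAutLin_pmul (x y : PIAlg F n) :
    PartialAut.conjMean F _ (toAutLin F n (pmul τ x y)) =
      PartialAut.conjMean F _ (PartialAut.mul τ
        (toAutLin F n (Finsupp.lmapDomain ℂ ℂ PartialIso.symm x)) (toAutLin F n y)) := by
  induction x using Finsupp.induction_linear with
  | zero => simp
  | add x x' hx hx' => simp only [map_add, LinearMap.add_apply, hx, hx']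
  | single G c =>
    induction y using Finsupp.induction_linear with
    | zero => simp
    | add y y' hy hy' => simp only [map_add, hy, hy']
    | single H d =>
      rw [Finsupp.lmapDomain_apply, Finsupp.mapDomain_single]
      simp only [pmul_single_single, map_smul, toAutLin_single, PartialAut.mul_single_single,
        conjMean_toAutLin_basisMul]

/-- On invariant elements, `toAutLin` is multiplicative. -/
lemma toAutLin_pmul {x y : PIAlg F n} (hx : x ∈ invariants F n) (hy : y ∈ invariants F n) :
    toAutLin F n (pmul τ x y) = PartialAut.mul τ (toAutLin F n x) (toAutLin F n y) := by
  have h := conjMean_toAutLin_pmul τ x y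
  -- Invariance removes the reversal of the first factor; below, it also removes both conjugation
  -- means.
  rw [Finsupp.lmapDomain_apply, mapDomain_symm_of_mem hx] at h
  rwa [PartialAut.conjMean_of_invariant (conjMap_toAutLin (pmul_mem_invariants τ hx hy)),
    PartialAut.conjMean_of_invariant fun a => by
      rw [PartialAut.conjMap_mul, conjMap_toAutLin hx, conjMap_toAutLin hy]] at h

end Invariants

/-! ### Fibres of `toAut` and counting of free families -/

namespace PartialIso

variable {F E : Type*} [Field F] [AddCommGroup E] [Module F E]

/-- Partial isomorphisms with a given automorphism `g₂ ∘ g₁` correspond to injective maps. -/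
noncomputable def fiberEquiv (p : PartialAut F E) :
    {a : p.space →ₗ[F] E // Function.Injective a} ≃ {G : PartialIso F E // G.toAut = p} := by
  refine Equiv.ofBijective (fun a => ⟨(ofInjective a.1 a.2 p.g).symm, ?_⟩) ⟨?_, ?_⟩
  · refine PartialAut.ext_of_values rfl fun x hx hx' => ?_
    exact congrArg Subtype.val (ofInjective_g₁ a.1 a.2 p.g ⟨x, hx⟩ ⟨_, rfl⟩)
  · intro a a' h
    refine Subtype.ext (LinearMap.ext fun x => ?_)
    exact g₁_congr (congrArg Subtype.val h) x x.2
  · rintro ⟨G, rfl⟩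
    let a : G.left →ₗ[F] E := G.right.subtype ∘ₗ G.g₁.toLinearMap
    have ha : Function.Injective a := Subtype.val_injective.comp G.g₁.injective
    refine ⟨⟨a, ha⟩, Subtype.ext (ext_of_values rfl ?_ (fun _ _ _ => rfl) ?_)⟩
    · ext x
      constructor
      · rintro ⟨y, rfl⟩
        exact (G.g₁ y).2
      · intro hx
        exact ⟨G.g₁.symm ⟨x, hx⟩, congrArg Subtype.val (G.g₁.apply_symm_apply ⟨x, hx⟩)⟩
    · rintro _ ⟨y, rfl⟩ hx
      exact congrArg Subtype.val (ofInjective_g₁ a ha G.toAut.g y ⟨y, rfl⟩)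

end PartialIso

section Counting

variable {F : Type*} [Field F]

lemma card_injective_linearMap {V E : Type*} [AddCommGroup V] [Module F V] [AddCommGroup E]
    [Module F E] {ι : Type*} (b : Module.Basis ι F V) :
    Nat.card {a : V →ₗ[F] E // Function.Injective a} =
      Nat.card {v : ι → E // LinearIndependent F v} := by
  refine Nat.card_congr (Equiv.subtypeEquiv (b.constr F).symm.toEquiv fun a => ?_)
  change _ ↔ LinearIndependent F fun i => a (b i)
  constructor
  · intro ha
    exact b.linearIndependent.map' a (LinearMap.ker_eq_bot.2 ha)
  · intro h
    let c := Module.Basis.span h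
    have : a = (Submodule.span F (Set.range fun i => a (b i))).subtype ∘ₗ
        (b.equiv c (Equiv.refl ι)).toLinearMap := by
      refine b.ext fun i => ?_
      simp [c, Module.Basis.span_apply]
    rw [this]
    exact Subtype.val_injective.comp (LinearEquiv.injective _)

variable (F)

lemma card_free_families (ι : Type*) [Fintype ι] (n : ℕ) :
    Nat.card {v : ι → (Fin n → F) // LinearIndependent F v} =
      Nat.card {v : Fin (Fintype.card ι) → (Fin n → F) // LinearIndependent F v} := by
  refine Nat.card_congr (Equiv.subtypeEquiv
    (Equiv.arrowCongr (Fintype.equivFin ι) (Equiv.refl _)) fun v => ?_)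
  exact (linearIndependent_equiv (Fintype.equivFin ι).symm).symm

variable [Finite F]

lemma qC_ne_zero : qC F ≠ 0 :=
  (Nat.cast_ne_zero (R := ℂ)).2 Nat.card_pos.ne'

lemma one_sub_qC_inv_pow_ne_zero (i : ℕ) : 1 - ((qC F)⁻¹) ^ (i + 1) ≠ 0 := by
  intro h
  have h1 : ((Nat.card F ^ (i + 1) : ℕ) : ℂ) = 1 := by
    rw [sub_eq_zero, inv_pow, eq_comm, inv_eq_one] at h
    rw [Nat.cast_pow]
    exact h
  have h2 : Nat.card F ^ (i + 1) = 1 := by exact_mod_cast h1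
  exact (Nat.one_lt_pow (Nat.succ_ne_zero i) Finite.one_lt_card).ne' h2

lemma qPoch_ne_zero (m : ℕ) : qPoch F m ≠ 0 :=
  Finset.prod_ne_zero_iff.2 fun i _ => one_sub_qC_inv_pow_ne_zero F i

/-- The number of free families of `k` vectors of `Fⁿ`. -/
lemma card_free_families_eq {n k : ℕ} (hk : k ≤ n) :
    (Nat.card {v : Fin k → (Fin n → F) // LinearIndependent F v} : ℂ) =
      (qC F) ^ (n * k) * qPoch F n / qPoch F (n - k) := by
  have := Fintype.ofFinite F
  have hq := qC_ne_zero F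
  rw [card_linearIndependent (by simpa using hk)]
  simp only [Module.finrank_fintype_fun_eq_card, Fintype.card_fin]
  rw [eq_div_iff (qPoch_ne_zero F _)]
  induction k with
  | zero => simp
  | succ k ih =>
    have h1 := ih (by omega)
    have h2 : n - k = (n - (k + 1)) + 1 := by omega
    rw [h2, qPoch, Finset.prod_range_succ, ← qPoch] at h1
    rw [Fin.prod_univ_castSucc, mul_add, pow_add, Nat.cast_mul]
    -- The number of choices for the next vector is `qⁿ(1 - q^(-(n-k)))`, and its second factor is
    -- the last one of `(q⁻¹)_(n-k)`.
    have h3 : ((Fintype.card F ^ n - Fintype.card F ^ k : ℕ) : ℂ) =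
        qC F ^ n * (1 - (qC F)⁻¹ ^ (n - (k + 1) + 1)) := by
      have h4 : qC F ^ n = qC F ^ k * qC F ^ (n - k) := by rw [← pow_add]; congr 1; omega
      have h5 : (Fintype.card F : ℂ) = qC F := by rw [qC, Nat.card_eq_fintype_card]
      rw [Nat.cast_sub (Nat.pow_le_pow_right Fintype.card_pos (by omega)), ← h2, mul_sub, mul_one,
        Nat.cast_pow, Nat.cast_pow, h5, inv_pow]
      nth_rw 3 [h4]
      rw [mul_inv_cancel_right₀ (pow_ne_zero _ hq)]
    simp only [Fin.val_castSucc, Fin.val_last]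
    rw [h3, mul_one]
    linear_combination (qC F ^ n) * h1

end Counting

/-! ### Injectivity of `toAutLin` on invariants -/

section Coefficients

variable {F : Type*} [Field F]

lemma mapDomain_apply_eq_sum {α β : Type*} [Fintype α] [DecidableEq β] (f : α → β) (x : α →₀ ℂ)
    (b : β) : Finsupp.mapDomain f x b = ∑ a, if f a = b then x a else 0 := by
  classical
  induction x using Finsupp.induction_linear with
  | zero => simp
  | add x y hx hy =>
    rw [Finsupp.mapDomain_add, Finsupp.add_apply, hx, hy, ← Finset.sum_add_distrib]
    refine Finset.sum_congr rfl fun a _ => ?_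
    split_ifs <;> simp
  | single a c =>
    rw [Finsupp.mapDomain_single, Finsupp.single_apply,
      Finset.sum_eq_single a (fun a' _ h => by simp [h.symm]) (by simp)]
    simp

variable (F) in
/-- The number of free families of `k` vectors of `Fⁿ`. -/
noncomputable def freeCount (n k : ℕ) : ℂ :=
  (Nat.card {v : Fin k → (Fin n → F) // LinearIndependent F v} : ℂ)

variable {n : ℕ}

lemma degree_le (G : PartialIso F (Fin n → F)) : G.degree ≤ n :=
  (Submodule.finrank_le _).trans (by simp)

variable [Finite F]

lemma freeCount_ne_zero {k : ℕ} (hk : k ≤ n) : freeCount F n k ≠ 0 := by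
  rw [freeCount, card_free_families_eq F hk]
  exact div_ne_zero (mul_ne_zero (pow_ne_zero _ (qC_ne_zero F)) (qPoch_ne_zero F _))
    (qPoch_ne_zero F _)

/-- An invariant element is constant on each fibre of `toAut`, so its pushforward is that constant
times the size of the fibre. -/
lemma toAutLin_apply {x : PIAlg F n} (hx : x ∈ invariants F n) (G : PartialIso F (Fin n → F)) :
    toAutLin F n x G.toAut = freeCount F n G.degree * x G := by
  classical
  have := Fintype.ofFinite (PartialIso F (Fin n → F))
  rw [toAutLin, Finsupp.lmapDomain_apply, mapDomain_apply_eq_sum]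
  have h : ∀ H : PartialIso F (Fin n → F),
      (if H.toAut = G.toAut then x H else 0) = if H.toAut = G.toAut then x G else 0 := by
    intro H
    split_ifs with hH
    · exact mem_invariants_iff.1 hx _ _ (hH ▸ PartialAut.Iso.refl _)
    · rfl
  rw [Finset.sum_congr rfl fun H _ => h H, ← Finset.sum_filter, Finset.sum_const, nsmul_eq_mul,
    ← Fintype.card_subtype, ← Nat.card_eq_fintype_card,
    ← Nat.card_congr (PartialIso.fiberEquiv G.toAut),
    card_injective_linearMap (Module.finBasis F G.toAut.space)]
  rfl

lemma toAutLin_injOn {x y : PIAlg F n} (hx : x ∈ invariants F n) (hy : y ∈ invariants F n)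
    (h : toAutLin F n x = toAutLin F n y) : x = y := by
  ext G
  have h1 := toAutLin_apply hx G
  rw [h, toAutLin_apply hy] at h1
  exact (mul_left_cancel₀ (freeCount_ne_zero (degree_le G)) h1).symm

end Coefficients

/-! ### Algebra laws on the invariants -/

section Unit

variable {F : Type*} [Field F] {n : ℕ}

lemma PartialIso.eq_empty {E : Type*} [AddCommGroup E] [Module F E] {G : PartialIso F E}
    (hl : G.left = ⊥) (hr : G.right = ⊥) : G = empty := by
  refine ext_of_values hl hr ?_ ?_
  · rintro x hx hx'
    have h : ∀ y ∈ G.right, y = 0 := by simp [hr]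
    obtain rfl := (Submodule.mem_bot F).1 hx'
    exact h _ (G.g₁ _).2
  · rintro x hx hx'
    have h : ∀ y ∈ G.left, y = 0 := by simp [hl]
    obtain rfl := (Submodule.mem_bot F).1 hx'
    exact h _ (G.g₂ _).2

lemma pone_mem_invariants : pone F n ∈ invariants F n := by
  rw [mem_invariants_iff_transport]
  intro a b
  have h : PartialIso.transport a b (PartialIso.empty : PartialIso F (Fin n → F)) = .empty :=
    PartialIso.eq_empty (Submodule.map_bot (a : (Fin n → F) →ₗ[F] (Fin n → F)))
      (Submodule.map_bot (b : (Fin n → F) →ₗ[F] (Fin n → F)))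
  rw [pone, Finsupp.mapDomain_single, h]

lemma pone_mem_invariantsDeg : pone F n ∈ invariantsDeg F n 0 :=
  ⟨pone_mem_invariants, Finsupp.single_mem_supported ℂ _ (finrank_bot F (Fin n → F))⟩

lemma toAutLin_pone : toAutLin F n (pone F n) = Finsupp.single (PartialAut.bot F _) 1 := by
  rw [pone, toAutLin_single]
  rfl

variable [Finite F] (τ : TrivialityNotion)

lemma pone_pmul {x : PIAlg F n} (hx : x ∈ invariants F n) : pmul τ (pone F n) x = x := by
  refine toAutLin_injOn (pmul_mem_invariants τ pone_mem_invariants hx) hx ?_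
  rw [toAutLin_pmul τ pone_mem_invariants hx, toAutLin_pone, PartialAut.mul_bot]

lemma pmul_comm_of_mem {x y : PIAlg F n} (hx : x ∈ invariants F n) (hy : y ∈ invariants F n) :
    pmul τ x y = pmul τ y x := by
  refine toAutLin_injOn (pmul_mem_invariants τ hx hy) (pmul_mem_invariants τ hy hx) ?_
  rw [toAutLin_pmul τ hx hy, toAutLin_pmul τ hy hx,
    PartialAut.mul_comm_of_invariant τ (conjMap_toAutLin hx) (conjMap_toAutLin hy)]

lemma pmul_assoc_of_mem {x y z : PIAlg F n} (hx : x ∈ invariants F n) (hy : y ∈ invariants F n)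
    (hz : z ∈ invariants F n) :
    pmul .quotient (pmul .quotient x y) z = pmul .quotient x (pmul .quotient y z) := by
  have : FiniteDimensional F (Fin n → F) := inferInstance
  have hxy := pmul_mem_invariants .quotient hx hy
  have hyz := pmul_mem_invariants .quotient hy hz
  refine toAutLin_injOn (pmul_mem_invariants _ hxy hz) (pmul_mem_invariants _ hx hyz) ?_
  rw [toAutLin_pmul _ hxy hz, toAutLin_pmul _ hx hyz, toAutLin_pmul _ hx hy,
    toAutLin_pmul _ hy hz, PartialAut.mul_assoc]

end Unit

/-! ### Decomposition by degree -/

section Grading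

variable {F : Type*} [Field F] {n : ℕ}

lemma iSupIndep_invariantsDeg : iSupIndep (invariantsDeg F n) := by
  intro k
  have h : (⨆ j, ⨆ _ : j ≠ k, invariantsDeg F n j) ≤
      Finsupp.supported ℂ ℂ {G : PartialIso F (Fin n → F) | G.degree ≠ k} := by
    refine iSup₂_le fun j hj => inf_le_right.trans (Finsupp.supported_mono ?_)
    rintro G rfl
    exact hj
  refine Disjoint.mono inf_le_right h ?_
  rw [Finsupp.disjoint_supported_supported_iff]
  exact Set.disjoint_left.2 fun G hG hG' => hG' hG

lemma mem_iSup_invariantsDeg {x : PIAlg F n} (hx : x ∈ invariants F n) (s : Set ℕ)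
    (hs : x ∈ Finsupp.supported ℂ ℂ {G : PartialIso F (Fin n → F) | G.degree ∈ s}) :
    x ∈ ⨆ m ∈ s, invariantsDeg F n m := by
  classical
  -- Degrees are at most `n`, so finitely many components suffice. Each is invariant because
  -- isomorphic automorphisms have spaces of equal dimension.
  have hsum : x = ∑ k ∈ (Finset.range (n + 1)).filter (· ∈ s),
      Finsupp.filter (fun G : PartialIso F (Fin n → F) => G.degree = k) x := by
    ext G
    rw [Finsupp.finsetSum_apply]
    by_cases hG : x G = 0
    · rw [hG, Finset.sum_eq_zero]
      intro k _
      rw [Finsupp.filter_apply, hG, ite_self]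
    · have hGs : G.degree ∈ s := hs (Finsupp.mem_support_iff.2 hG)
      rw [Finset.sum_eq_single G.degree]
      · simp
      · intro k _ hk
        rw [Finsupp.filter_apply, if_neg hk.symm]
      · intro h
        exact absurd (Finset.mem_filter.2
          ⟨Finset.mem_range.2 (Nat.lt_succ_of_le (degree_le G)), hGs⟩) h
  rw [hsum]
  refine Submodule.sum_mem _ fun k hk => ?_
  refine Submodule.mem_iSup_of_mem k (Submodule.mem_iSup_of_mem (Finset.mem_filter.1 hk).2 ⟨?_, ?_⟩)
  · refine mem_invariants_iff.2 fun G H h => ?_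
    have hd : G.degree = H.degree := h.finrank_eq
    rw [Finsupp.filter_apply, Finsupp.filter_apply, hd, mem_invariants_iff.1 hx G H h]
  · intro G hG
    by_contra h
    exact (Finsupp.mem_support_iff.1 hG) (Finsupp.filter_apply_neg _ _ h)

lemma iSup_invariantsDeg : (⨆ k, invariantsDeg F n k) = invariants F n := by
  refine le_antisymm (iSup_le fun k => inf_le_left) fun x hx => ?_
  have := mem_iSup_invariantsDeg hx Set.univ (by simp)
  simpa using this

variable [Finite F]

lemma basisMul_mem_supported (τ : TrivialityNotion) (G H : PartialIso F (Fin n → F)) :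
    basisMul τ G H ∈ Finsupp.supported ℂ ℂ
      {K : PartialIso F (Fin n → F) | K.degree ≤ G.degree + H.degree} := by
  refine Submodule.smul_mem _ _ (Submodule.sum_mem _ fun G' _ => Submodule.sum_mem _ fun H' _ =>
    Finsupp.single_mem_supported ℂ _ ?_)
  change Module.finrank F G'.1.left ≤ _
  rw [G'.1.g₁.finrank_eq, G'.2.2]
  refine (Submodule.finrank_add_le_finrank_add_finrank _ _).trans ?_
  rw [← G.g₁.finrank_eq]
  rfl

lemma pmul_mem_supported (τ : TrivialityNotion) {k l : ℕ} {x y : PIAlg F n}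
    (hx : x ∈ Finsupp.supported ℂ ℂ {G : PartialIso F (Fin n → F) | G.degree = k})
    (hy : y ∈ Finsupp.supported ℂ ℂ {G : PartialIso F (Fin n → F) | G.degree = l}) :
    pmul τ x y ∈ Finsupp.supported ℂ ℂ
      {G : PartialIso F (Fin n → F) | G.degree ∈ Set.Iic (k + l)} := by
  rw [pmul, Finsupp.linearCombination_apply, Finsupp.sum, LinearMap.sum_apply]
  refine Submodule.sum_mem _ fun G hG => ?_
  rw [LinearMap.smul_apply, Finsupp.linearCombination_apply, Finsupp.sum]
  refine Submodule.smul_mem _ _ (Submodule.sum_mem _ fun H hH => Submodule.smul_mem _ _ ?_)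
  obtain rfl : G.degree = k := hx hG
  obtain rfl : H.degree = l := hy hH
  exact basisMul_mem_supported τ G H

end Grading

/-! ### Truncation of partial automorphisms to a subspace -/

section Truncation

variable {F E E' : Type*} [Field F] [AddCommGroup E] [Module F E] [AddCommGroup E'] [Module F E']
  (τ : TrivialityNotion) (ι : E' →ₗ[F] E) (hι : Function.Injective ι)

namespace PartialAut

/-- Truncation to the partial automorphisms of a subspace. -/
noncomputable def trunc : (PartialAut F E →₀ ℂ) →ₗ[ℂ] (PartialAut F E' →₀ ℂ) :=
  Finsupp.lcomapDomain (map ι hι) (map_injective ι hι)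

lemma trunc_apply (z : PartialAut F E →₀ ℂ) (p : PartialAut F E') :
    trunc ι hι z p = z (map ι hι p) := rfl

lemma trunc_lmapDomain (z : PartialAut F E' →₀ ℂ) :
    trunc ι hι (Finsupp.lmapDomain ℂ ℂ (map ι hι) z) = z :=
  Finsupp.leftInverse_lcomapDomain_mapDomain _ (map_injective ι hι) z

lemma trunc_single_map (p : PartialAut F E') (c : ℂ) :
    trunc ι hι (Finsupp.single (map ι hι p) c) = Finsupp.single p c := by
  rw [← trunc_lmapDomain ι hι (Finsupp.single p c), Finsupp.lmapDomain_apply,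
    Finsupp.mapDomain_single]

lemma trunc_single_of_not_le {p : PartialAut F E} (h : ¬ p.space ≤ LinearMap.range ι) (c : ℂ) :
    trunc ι hι (Finsupp.single p c) = 0 := by
  classical
  ext p'
  rw [trunc_apply, Finsupp.single_apply, if_neg]
  · rfl
  · rintro rfl
    exact h LinearMap.map_le_range

variable [Finite E] [Finite E']

/-- Every term of the product lives on exactly `p.space + p'.space`. Either this lies in the
subspace and nothing is lost, or the product and at least one factor are truncated to zero. -/
lemma trunc_basisMul (p p' : PartialAut F E) :
    trunc ι hι (basisMul τ p p') =
      mul τ (trunc ι hι (Finsupp.single p 1)) (trunc ι hι (Finsupp.single p' 1)) := by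
  by_cases h : p.space ⊔ p'.space ≤ LinearMap.range ι
  · obtain ⟨p, rfl⟩ := exists_map_eq ι hι (le_sup_left.trans h)
    obtain ⟨p', rfl⟩ := exists_map_eq ι hι (le_sup_right.trans h)
    rw [basisMul_map, trunc_lmapDomain, trunc_single_map, trunc_single_map, mul_single_single,
      one_smul, one_smul]
  · have h0 : trunc ι hι (basisMul τ p p') = 0 := by
      rw [basisMul, mulOn]
      simp only [map_avg]
      refine (avg_congr fun γ => avg_congr fun η => trunc_single_of_not_le ι hι h 1).trans ?_
      simp [avg]
    rw [h0]
    by_cases hp : p.space ≤ LinearMap.range ι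
    · rw [trunc_single_of_not_le ι hι (p := p') (fun hp' => h (sup_le hp hp')), map_zero]
    · rw [trunc_single_of_not_le ι hι hp, map_zero, LinearMap.zero_apply]

lemma trunc_mul (x y : PartialAut F E →₀ ℂ) :
    trunc ι hι (mul τ x y) = mul τ (trunc ι hι x) (trunc ι hι y) := by
  induction x using Finsupp.induction_linear with
  | zero => simp
  | add x x' hx hx' => simp only [_root_.map_add, LinearMap.add_apply, hx, hx']
  | single p c =>
    induction y using Finsupp.induction_linear with
    | zero => simp
    | add y y' hy hy' => simp only [_root_.map_add, hy, hy']
    | single p' c' =>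
      rw [mul_single_single, _root_.map_smul, _root_.map_smul, trunc_basisMul,
        ← mul_one c, ← mul_one c', ← smul_eq_mul, ← smul_eq_mul, ← Finsupp.smul_single,
        ← Finsupp.smul_single]
      simp only [_root_.map_smul, LinearMap.smul_apply, smul_eq_mul, mul_one]
      rw [smul_comm]

end PartialAut

end Truncation

/-! ### The maps between levels -/

section Phi

variable {F : Type*} [Field F] {n N : ℕ} (h : n ≤ N)

/-- Partial isomorphisms of `Fⁿ` seen in `Fᴺ`. -/
noncomputable def embIso (G : PartialIso F (Fin n → F)) : PartialIso F (Fin N → F) :=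
  G.map (stdEmb F h) (stdEmb_injective F h)

variable (F n N) in
/-- The scalar by which `φᴺₙ` multiplies the partial isomorphisms of degree `k` of `Fⁿ`. -/
noncomputable def phiCoef (k : ℕ) : ℂ :=
  (qC F) ^ ((N - n) * k) * ((qPoch F N * qPoch F (n - k)) / (qPoch F (N - k) * qPoch F n))

lemma phi_apply (x : PIAlg F N) (G : PartialIso F (Fin n → F)) :
    phi F h x G = phiCoef F n N G.degree * x (embIso h G) := by
  classical
  induction x using Finsupp.induction_linear with
  | zero => simp
  | add x y hx hy => rw [map_add, Finsupp.add_apply, hx, hy, Finsupp.add_apply, mul_add]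
  | single H c =>
    rw [phi, Finsupp.linearCombination_single]
    by_cases hH : H = embIso h G
    · subst hH
      have hG : (embIso h G).left ⊔ (embIso h G).right ≤ LinearMap.range (stdEmb F h) :=
        PartialIso.map_left_sup_right_le (stdEmb F h) (stdEmb_injective F h) G
      rw [dif_pos hG, Finsupp.smul_apply, Finsupp.single_eq_same]
      have h1 : (embIso h G).restrict (stdEmb F h) (stdEmb_injective F h) hG = G :=
        PartialIso.restrict_map _ _ G hG
      have h2 : (embIso h G).degree = G.degree := PartialIso.degree_map _ _ G
      rw [h1, h2, Finsupp.single_eq_same, smul_eq_mul, mul_comm]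
      rfl
    · rw [Finsupp.single_apply, if_neg hH, mul_zero]
      split_ifs with hG
      · rw [Finsupp.smul_apply, Finsupp.single_apply, if_neg, smul_zero]
        rintro rfl
        exact hH (PartialIso.map_restrict _ _ _ _).symm
      · simp

lemma iso_embIso (G : PartialIso F (Fin n → F)) : PartialAut.Iso G.toAut (embIso h G).toAut := by
  rw [embIso, PartialIso.toAut_map]
  exact PartialAut.iso_map _ _ _

lemma phi_mem_invariants {x : PIAlg F N} (hx : x ∈ invariants F N) :
    phi F h x ∈ invariants F n := by
  refine mem_invariants_iff.2 fun G H hGH => ?_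
  have hd : G.degree = H.degree := hGH.finrank_eq
  rw [phi_apply, phi_apply, hd, mem_invariants_iff.1 hx (embIso h G) (embIso h H)]
  exact ((iso_embIso h G).symm.trans hGH).trans (iso_embIso h H)

lemma phi_mem_invariantsDeg {k : ℕ} {x : PIAlg F N} (hx : x ∈ invariantsDeg F N k) :
    phi F h x ∈ invariantsDeg F n k := by
  refine ⟨phi_mem_invariants h hx.1, fun G hG => ?_⟩
  rw [Finset.mem_coe, Finsupp.mem_support_iff, phi_apply] at hG
  have h1 : (embIso h G).degree = k := hx.2 (Finsupp.mem_support_iff.2 (right_ne_zero_of_mul hG))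
  exact (PartialIso.degree_map _ _ G).symm.trans h1

lemma stdEmb_apply (v : Fin n → F) (i : Fin N) :
    stdEmb F h v i = if hi : (i : ℕ) < n then v ⟨i, hi⟩ else 0 := by
  split_ifs with hi
  · exact (Fin.castLE_injective h).extend_apply v (0 : Fin N → F) ⟨i, hi⟩
  · refine Function.extend_apply' v (0 : Fin N → F) i ?_
    rintro ⟨j, rfl⟩
    exact hi j.2

lemma stdEmb_refl : stdEmb F (le_refl n) = LinearMap.id := by
  refine LinearMap.ext fun v => funext fun i => ?_
  rw [stdEmb_apply, dif_pos i.2]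
  rfl

lemma stdEmb_comp {m : ℕ} (h₁ : n ≤ m) (h₂ : m ≤ N) :
    stdEmb F h₂ ∘ₗ stdEmb F h₁ = stdEmb F (h₁.trans h₂) := by
  refine LinearMap.ext fun v => funext fun i => ?_
  rw [LinearMap.comp_apply]
  simp only [stdEmb_apply]
  by_cases hi : (i : ℕ) < n
  · simp [hi, hi.trans_le h₁]
  · simp [hi]

variable [Finite F]

lemma phiCoef_ne_zero (k : ℕ) : phiCoef F n N k ≠ 0 :=
  mul_ne_zero (pow_ne_zero _ (qC_ne_zero F)) (div_ne_zero
    (mul_ne_zero (qPoch_ne_zero F _) (qPoch_ne_zero F _))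
    (mul_ne_zero (qPoch_ne_zero F _) (qPoch_ne_zero F _)))

include h in
-- This explains the scalar in `phi`: it corrects the change in size of the fibres of `toAut` from
-- `Fⁿ` to `Fᴺ`.
lemma freeCount_mul_phiCoef {k : ℕ} (hk : k ≤ n) :
    freeCount F n k * phiCoef F n N k = freeCount F N k := by
  rw [freeCount, freeCount, card_free_families_eq F hk, card_free_families_eq F (hk.trans h),
    phiCoef]
  have h1 : qC F ^ (N * k) = qC F ^ (n * k) * qC F ^ ((N - n) * k) := by
    rw [← pow_add, ← add_mul, Nat.add_sub_cancel' h]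
  rw [h1]
  have := qPoch_ne_zero F n
  have := qPoch_ne_zero F (n - k)
  have := qPoch_ne_zero F (N - k)
  field_simp

lemma toAutLin_phi {x : PIAlg F N} (hx : x ∈ invariants F N) :
    toAutLin F n (phi F h x) =
      PartialAut.trunc (stdEmb F h) (stdEmb_injective F h) (toAutLin F N x) := by
  ext p
  -- Every partial automorphism is hit, with equal subspaces and `g₁` the identity, so the formula
  -- for coefficients applies everywhere.
  obtain ⟨G, rfl⟩ : ∃ G : PartialIso F (Fin n → F), G.toAut = p :=
    ⟨⟨p.space, p.space, LinearEquiv.refl F _, p.g⟩, rfl⟩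
  rw [toAutLin_apply (phi_mem_invariants h hx), phi_apply, PartialAut.trunc_apply,
    ← PartialIso.toAut_map, toAutLin_apply hx, PartialIso.degree_map, ← mul_assoc,
    freeCount_mul_phiCoef h (degree_le G)]
  rfl

lemma phi_pmul (τ : TrivialityNotion) {x y : PIAlg F N} (hx : x ∈ invariants F N)
    (hy : y ∈ invariants F N) : phi F h (pmul τ x y) = pmul τ (phi F h x) (phi F h y) := by
  have hxy := pmul_mem_invariants τ hx hy
  have hx' := phi_mem_invariants h hx
  have hy' := phi_mem_invariants h hy
  refine toAutLin_injOn (phi_mem_invariants h hxy) (pmul_mem_invariants τ hx' hy') ?_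
  rw [toAutLin_phi h hxy, toAutLin_pmul τ hx hy, PartialAut.trunc_mul, toAutLin_pmul τ hx' hy',
    toAutLin_phi h hx, toAutLin_phi h hy]

lemma phi_pone : phi F h (pone F N) = pone F n := by
  refine toAutLin_injOn (phi_mem_invariants h pone_mem_invariants) pone_mem_invariants ?_
  rw [toAutLin_phi h pone_mem_invariants, toAutLin_pone, toAutLin_pone]
  have h1 : PartialAut.map (stdEmb F h) (stdEmb_injective F h) (PartialAut.bot F _) =
      PartialAut.bot F _ := by
    refine PartialAut.ext_of_values (Submodule.map_bot _) fun x hx hx' => ?_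
    obtain rfl := (Submodule.mem_bot F).1 hx'
    exact congrArg Subtype.val (map_zero (PartialAut.map (stdEmb F h) _ (PartialAut.bot F _)).g)
  rw [← h1, PartialAut.trunc_single_map]

lemma exists_phi_eq {y : PIAlg F n} (hy : y ∈ invariants F n) :
    ∃ x ∈ invariants F N, phi F h x = y := by
  classical
  -- The lift is prescribed orbit by orbit: orbits meeting `Fⁿ` receive the rescaled coefficient of
  -- `y`, the others zero. The chosen representative is immaterial since `y` is invariant.
  let f : PartialIso F (Fin N → F) → ℂ := fun H =>
    if hH : ∃ G : PartialIso F (Fin n → F), PartialAut.Iso G.toAut H.toAut then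
      (phiCoef F n N H.degree)⁻¹ * y hH.choose
    else 0
  have hf : ∀ (G : PartialIso F (Fin n → F)) (H : PartialIso F (Fin N → F)),
      PartialAut.Iso G.toAut H.toAut → f H = (phiCoef F n N H.degree)⁻¹ * y G := by
    intro G H hGH
    have hH : ∃ G : PartialIso F (Fin n → F), PartialAut.Iso G.toAut H.toAut := ⟨G, hGH⟩
    simp only [f, dif_pos hH]
    rw [mem_invariants_iff.1 hy _ G (hH.choose_spec.trans hGH.symm)]
  refine ⟨Finsupp.equivFunOnFinite.symm f, mem_invariants_iff.2 fun H H' hHH' => ?_, ?_⟩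
  · rw [Finsupp.equivFunOnFinite_symm_apply_apply, Finsupp.equivFunOnFinite_symm_apply_apply]
    by_cases hH : ∃ G : PartialIso F (Fin n → F), PartialAut.Iso G.toAut H.toAut
    · obtain ⟨G, hG⟩ := hH
      have hd : H.degree = H'.degree := hHH'.finrank_eq
      rw [hf G H hG, hf G H' (hG.trans hHH'), hd]
    · have hH' : ¬ ∃ G : PartialIso F (Fin n → F), PartialAut.Iso G.toAut H'.toAut :=
        fun ⟨G, hG⟩ => hH ⟨G, hG.trans hHH'.symm⟩
      simp only [f, dif_neg hH, dif_neg hH']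
  · ext G
    have hd : (embIso h G).degree = G.degree := PartialIso.degree_map _ _ G
    rw [phi_apply, Finsupp.equivFunOnFinite_symm_apply_apply, hf G _ (iso_embIso h G), hd,
      mul_inv_cancel_left₀ (phiCoef_ne_zero _)]

lemma phi_refl : phi F (le_refl n) = LinearMap.id := by
  refine LinearMap.ext fun x => Finsupp.ext fun G => ?_
  have h1 : embIso (le_refl n) G = G := by
    have : stdEmb F (le_refl n) = LinearMap.id := stdEmb_refl
    refine (PartialIso.eq_map _ _ ?_ ?_ ?_ ?_).symm <;> simp [this]
  rw [phi_apply, h1, phiCoef]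
  have := qPoch_ne_zero F n
  have := qPoch_ne_zero F (n - G.degree)
  simp only [Nat.sub_self, zero_mul, pow_zero, one_mul, LinearMap.id_apply]
  field_simp

lemma phi_comp {m : ℕ} (h₁ : n ≤ m) (h₂ : m ≤ N) :
    phi F h₁ ∘ₗ phi F h₂ = phi F (h₁.trans h₂) := by
  refine LinearMap.ext fun x => Finsupp.ext fun G => ?_
  have h1 : embIso h₂ (embIso h₁ G) = embIso (h₁.trans h₂) G := by
    rw [embIso, embIso, PartialIso.map_map]
    simp only [stdEmb_comp]
    rfl
  have hd : (embIso h₁ G).degree = G.degree := PartialIso.degree_map _ _ G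
  rw [LinearMap.comp_apply, phi_apply, phi_apply, phi_apply, h1, hd, ← mul_assoc]
  congr 1
  rw [phiCoef, phiCoef, phiCoef]
  have := qPoch_ne_zero F n
  have := qPoch_ne_zero F m
  have := qPoch_ne_zero F (n - G.degree)
  have := qPoch_ne_zero F (N - G.degree)
  have := qPoch_ne_zero F (m - G.degree)
  have h2 : qC F ^ ((N - n) * G.degree) =
      qC F ^ ((m - n) * G.degree) * qC F ^ ((N - m) * G.degree) := by
    rw [← pow_add, ← add_mul]
    congr 2
    omega
  rw [h2]
  field_simp

end Phi

/-! ### Partial isomorphisms written in bases -/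

namespace PartialIso

variable {F E E' : Type*} [Field F] [AddCommGroup E] [Module F E] [AddCommGroup E'] [Module F E']
  {ι : Type*}

lemma map_span_range (κ : E' →ₗ[F] E) (e : ι → E') :
    (Submodule.span F (Set.range e)).map κ = Submodule.span F (Set.range (κ ∘ e)) := by
  rw [Submodule.map_span, ← Set.range_comp]

variable [Fintype ι] [DecidableEq ι] {J : Matrix ι ι F} {hJ : IsUnit J.det}

lemma ofFamilies_g₁ {e f : ι → E} (he : LinearIndependent F e) (hf : LinearIndependent F f)
    (i : ι) (hi : e i ∈ (ofFamilies e f he hf J hJ).left) :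
    ((ofFamilies e f he hf J hJ).g₁ ⟨e i, hi⟩ : E) = f i := by
  have h : (⟨e i, hi⟩ : (ofFamilies e f he hf J hJ).left) = Module.Basis.span he i :=
    (Module.Basis.span_apply he i).symm
  rw [h]
  change ((Module.Basis.span he).equiv (Module.Basis.span hf) (Equiv.refl ι)
    (Module.Basis.span he i) : E) = _
  rw [Module.Basis.equiv_apply, Module.Basis.span_apply]
  rfl

lemma ofFamilies_g₂ {e f : ι → E} (he : LinearIndependent F e) (hf : LinearIndependent F f)
    (j : ι) (hj : f j ∈ (ofFamilies e f he hf J hJ).right) :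
    ((ofFamilies e f he hf J hJ).g₂ ⟨f j, hj⟩ : E) = ∑ i, J i j • e i := by
  have h : (⟨f j, hj⟩ : (ofFamilies e f he hf J hJ).right) = Module.Basis.span hf j :=
    (Module.Basis.span_apply hf j).symm
  rw [h]
  change (Matrix.toLin (Module.Basis.span he) (Module.Basis.span he) J
    ((Module.Basis.span hf).equiv (Module.Basis.span he) (Equiv.refl ι)
      (Module.Basis.span hf j)) : E) = _
  rw [Module.Basis.equiv_apply, Equiv.refl_apply, Matrix.toLin_self]
  simp [Module.Basis.span_apply]

/-- A partial isomorphism is determined by its values on bases. -/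
lemma eq_ofFamilies {e f : ι → E} (he : LinearIndependent F e) (hf : LinearIndependent F f)
    {H : PartialIso F E} (hl : H.left = Submodule.span F (Set.range e))
    (hr : H.right = Submodule.span F (Set.range f))
    (h₁ : ∀ i (hi : e i ∈ H.left), (H.g₁ ⟨e i, hi⟩ : E) = f i)
    (h₂ : ∀ j (hj : f j ∈ H.right), (H.g₂ ⟨f j, hj⟩ : E) = ∑ i, J i j • e i) :
    H = ofFamilies e f he hf J hJ := by
  obtain ⟨V, W, a, b⟩ := H
  obtain rfl : V = _ := hl
  obtain rfl : W = _ := hr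
  have ha : a = (ofFamilies e f he hf J hJ).g₁ := by
    refine (Module.Basis.span he).ext' fun i => Subtype.ext ?_
    have h : Module.Basis.span he i = ⟨e i, Submodule.subset_span ⟨i, rfl⟩⟩ :=
      Module.Basis.span_apply he i
    rw [h]
    exact (h₁ i _).trans (ofFamilies_g₁ he hf i _).symm
  have hb : b = (ofFamilies e f he hf J hJ).g₂ := by
    refine (Module.Basis.span hf).ext' fun i => Subtype.ext ?_
    have h : Module.Basis.span hf i = ⟨f i, Submodule.subset_span ⟨i, rfl⟩⟩ :=
      Module.Basis.span_apply hf i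
    rw [h]
    exact (h₂ i _).trans (ofFamilies_g₂ he hf i _).symm
  subst ha hb
  rfl

lemma map_ofFamilies (κ : E' →ₗ[F] E) (hκ : Function.Injective κ) {e f : ι → E'}
    (he : LinearIndependent F e) (hf : LinearIndependent F f)
    (he' : LinearIndependent F (κ ∘ e)) (hf' : LinearIndependent F (κ ∘ f)) :
    map κ hκ (ofFamilies e f he hf J hJ) = ofFamilies (κ ∘ e) (κ ∘ f) he' hf' J hJ := by
  refine eq_ofFamilies he' hf' (map_span_range κ e) (map_span_range κ f) ?_ ?_
  · intro i hi
    have hi' : e i ∈ (ofFamilies e f he hf J hJ).left := Submodule.subset_span ⟨i, rfl⟩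
    exact (map_g₁ κ hκ _ (e i) hi' hi).trans (congrArg κ (ofFamilies_g₁ he hf i hi'))
  · intro j hj
    have hj' : f j ∈ (ofFamilies e f he hf J hJ).right := Submodule.subset_span ⟨j, rfl⟩
    refine (map_g₂ κ hκ _ (f j) hj' hj).trans
      ((congrArg κ (ofFamilies_g₂ he hf j hj')).trans ?_)
    simp

lemma transport_ofFamilies (a b : E ≃ₗ[F] E) {e f : ι → E}
    (he : LinearIndependent F e) (hf : LinearIndependent F f)
    (he' : LinearIndependent F (a ∘ e)) (hf' : LinearIndependent F (b ∘ f)) :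
    transport a b (ofFamilies e f he hf J hJ) = ofFamilies (a ∘ e) (b ∘ f) he' hf' J hJ := by
  refine eq_ofFamilies he' hf' (map_span_range (a : E →ₗ[F] E) e)
    (map_span_range (b : E →ₗ[F] E) f) ?_ ?_
  · intro i hi
    have hi' : e i ∈ (ofFamilies e f he hf J hJ).left := Submodule.subset_span ⟨i, rfl⟩
    exact (transport_g₁ a b _ (e i) hi' hi).trans (congrArg b (ofFamilies_g₁ he hf i hi'))
  · intro j hj
    have hj' : f j ∈ (ofFamilies e f he hf J hJ).right := Submodule.subset_span ⟨j, rfl⟩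
    refine (transport_g₂ a b _ (f j) hj' hj).trans
      ((congrArg a (ofFamilies_g₂ he hf j hj')).trans ?_)
    simp

lemma degree_ofFamilies {e f : ι → E} (he : LinearIndependent F e)
    (hf : LinearIndependent F f) : (ofFamilies e f he hf J hJ).degree = Fintype.card ι :=
  finrank_span_eq_card he

end PartialIso

/-! ### The classes attached to polypartitions -/

namespace Polypartition

variable {F : Type*} [Field F] (μ : Polypartition F)

lemma card_idx : Fintype.card μ.Idx = μ.size := by
  classical
  have h1 : ∀ b : μ.Block, (μ.blockPoly b).natDegree = (b.2.1 : ℕ) * b.1.1.1.natDegree :=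
    fun b => natDegree_pow _ _
  have h2 : ∀ m : Multiset ℕ+, ∑ x : m.ToType, ((x.1 : ℕ+) : ℕ) =
      (m.map fun j : ℕ+ => (j : ℕ)).sum := by
    intro m
    conv_rhs => rw [← Multiset.map_univ_coe m]
    rw [Multiset.map_map]
    rfl
  simp only [Fintype.card_sigma, Fintype.card_fin, h1]
  rw [Fintype.sum_sigma]
  simp only [← Finset.sum_mul, h2]
  rw [size, Finsupp.sum, ← Finset.sum_coe_sort μ.support]
  exact Finset.sum_congr rfl fun P _ => mul_comm _ _

variable {n N : ℕ}

/-- Image of a free family by an injective linear map. -/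
def mapFamily (κ : (Fin n → F) →ₗ[F] (Fin N → F)) (hκ : Function.Injective κ)
    (e : μ.FreeFamily n) : μ.FreeFamily N :=
  ⟨κ ∘ e.1, e.2.map' κ (LinearMap.ker_eq_bot.2 hκ)⟩

lemma mapFamily_injective (κ : (Fin n → F) →ₗ[F] (Fin N → F)) (hκ : Function.Injective κ) :
    Function.Injective (μ.mapFamily κ hκ) := by
  intro e e' h
  exact Subtype.ext (funext fun i => hκ (congrFun (congrArg Subtype.val h) i))

variable [Finite F]

lemma card_freeFamily : (Fintype.card (μ.FreeFamily n) : ℂ) = freeCount F n μ.size := by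
  classical
  rw [freeCount, ← card_idx, ← card_free_families F μ.Idx n, ← Nat.card_eq_fintype_card]
  rfl

/-- The two families are chosen independently, so the number of terms is a perfect square and the
normalization is the number of free families. -/
lemma hatA_eq : μ.hatA n = (freeCount F n μ.size)⁻¹ • μ.classA n := by
  have h : μ.cardA n = Fintype.card (μ.FreeFamily n) ^ 2 := by
    rw [cardA, Fintype.card_prod, sq]
  rw [hatA, h, Nat.cast_pow, Real.sqrt_sq (Nat.cast_nonneg _), ← card_freeFamily,
    Complex.ofReal_natCast]

lemma classA_mem_invariants : μ.classA n ∈ invariants F n := by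
  classical
  have hbij : ∀ a : (Fin n → F) ≃ₗ[F] (Fin n → F),
      Function.Bijective (μ.mapFamily (a : (Fin n → F) →ₗ[F] (Fin n → F)) a.injective) :=
    fun a => Finite.injective_iff_bijective.1 (mapFamily_injective _ _ _)
  rw [mem_invariants_iff_transport]
  intro a b
  have h := map_sum (Finsupp.lmapDomain ℂ ℂ (PartialIso.transport a b))
    (fun e : μ.FreeFamily n => ∑ f : μ.FreeFamily n, Finsupp.single
      (PartialIso.ofFamilies e.1 f.1 e.2 f.2 μ.jordan μ.isUnit_det_jordan) (1 : ℂ)) Finset.univ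
  rw [classA]
  refine h.trans ?_
  symm
  rw [← Equiv.sum_comp (Equiv.ofBijective _ (hbij a))]
  refine Finset.sum_congr rfl fun e _ => ?_
  rw [map_sum, ← Equiv.sum_comp (Equiv.ofBijective _ (hbij b))]
  refine Finset.sum_congr rfl fun f _ => ?_
  rw [Finsupp.lmapDomain_apply, Finsupp.mapDomain_single]
  congr 1
  exact (PartialIso.transport_ofFamilies a b e.2 f.2 _ _).symm

lemma classA_mem_invariantsDeg : μ.classA n ∈ invariantsDeg F n μ.size := by
  refine ⟨μ.classA_mem_invariants, Submodule.sum_mem _ fun e _ => Submodule.sum_mem _ fun f _ =>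
    Finsupp.single_mem_supported ℂ _ ?_⟩
  classical
  rw [← card_idx]
  exact PartialIso.degree_ofFamilies e.2 f.2

lemma hatA_mem_invariantsDeg : μ.hatA n ∈ invariantsDeg F n μ.size :=
  Submodule.smul_mem _ _ μ.classA_mem_invariantsDeg

/-- A pair of families in `Fᴺ` producing an embedded partial isomorphism spans subspaces of `Fⁿ`,
hence consists of families in `Fⁿ`. -/
lemma classA_apply_embIso (h : n ≤ N) (G : PartialIso F (Fin n → F)) :
    μ.classA N (embIso h G) = μ.classA n G := by
  classical
  set κ := stdEmb F h with hκ'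
  have hκ : Function.Injective κ := stdEmb_injective F h
  have hrange : ∀ (e : μ.FreeFamily N), Submodule.span F (Set.range e.1) ≤ LinearMap.range κ →
      e ∈ Set.range (μ.mapFamily κ hκ) := by
    intro e he
    choose v hv using fun i => he (Submodule.subset_span (Set.mem_range_self i))
    have hve : κ ∘ v = e.1 := funext hv
    exact ⟨⟨v, LinearIndependent.of_comp κ (hve ▸ e.2)⟩, Subtype.ext hve⟩
  simp only [classA, Finsupp.finsetSum_apply]
  have hG := PartialIso.map_left_sup_right_le κ hκ G
  symm
  refine Fintype.sum_of_injective _ (μ.mapFamily_injective κ hκ) _ _ ?_ fun e => ?_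
  · intro e he
    refine Finset.sum_eq_zero fun f _ => ?_
    rw [Finsupp.single_apply, if_neg]
    intro hef
    refine he (hrange e ?_)
    exact (congrArg PartialIso.left hef).le.trans (le_sup_left.trans hG)
  · refine Fintype.sum_of_injective _ (μ.mapFamily_injective κ hκ) _ _ ?_ fun f => ?_
    · intro f hf
      rw [Finsupp.single_apply, if_neg]
      intro hef
      refine hf (hrange f ?_)
      exact (congrArg PartialIso.right hef).le.trans (le_sup_right.trans hG)
    · rw [Finsupp.single_apply, Finsupp.single_apply]
      refine if_congr ?_ rfl rfl
      have h1 := PartialIso.map_ofFamilies κ hκ (J := μ.jordan) (hJ := μ.isUnit_det_jordan) e.2 f.2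
        (μ.mapFamily κ hκ e).2 (μ.mapFamily κ hκ f).2
      refine (PartialIso.map_injective κ hκ).eq_iff.symm.trans ?_
      rw [h1]
      rfl

lemma phi_classA (h : n ≤ N) : phi F h (μ.classA N) = phiCoef F n N μ.size • μ.classA n := by
  ext G
  rw [phi_apply, classA_apply_embIso, Finsupp.smul_apply, smul_eq_mul]
  by_cases hG : μ.classA n G = 0
  · rw [hG, mul_zero, mul_zero]
  · rw [show G.degree = μ.size from μ.classA_mem_invariantsDeg.2 (Finsupp.mem_support_iff.2 hG)]

lemma phi_hatA (h : n ≤ N) : phi F h (μ.hatA N) = μ.hatA n := by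
  rw [hatA_eq, hatA_eq, map_smul, phi_classA, smul_smul]
  by_cases hk : μ.size ≤ n
  · have h1 := freeCount_ne_zero (F := F) hk
    have h2 := phiCoef_ne_zero (F := F) (n := n) (N := N) μ.size
    rw [← freeCount_mul_phiCoef h hk, mul_inv, mul_assoc, inv_mul_cancel₀ h2, mul_one]
  -- No partial isomorphism of `Fⁿ` has degree above `n`, so both sides vanish.
  · have h0 : μ.classA n = 0 := by
      ext G
      by_contra hG
      have hd : G.degree = μ.size :=
        μ.classA_mem_invariantsDeg.2 (Finsupp.mem_support_iff.2 hG)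
      exact hk (hd ▸ degree_le G)
    rw [h0, smul_zero, smul_zero]

lemma hatA_eq_of_le (hk : μ.size ≤ n) : μ.hatA n =
    (qPoch F (n - μ.size) / ((qC F) ^ (n * μ.size) * qPoch F n)) • μ.classA n := by
  rw [hatA_eq, freeCount, card_free_families_eq F hk, inv_div]

end Polypartition

theorem mainTheorem5 (F : Type*) [Field F] [Finite F] :
    -- each `𝒵(n, F)` is a commutative graded algebra (associative in the quotient sense)
    (∀ (τ : TrivialityNotion) (n : ℕ),
      (∀ x ∈ invariants F n, ∀ y ∈ invariants F n, pmul τ x y ∈ invariants F n) ∧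
      (∀ x ∈ invariants F n, ∀ y ∈ invariants F n, pmul τ x y = pmul τ y x) ∧
      pone F n ∈ invariantsDeg F n 0 ∧
      (∀ x ∈ invariants F n, pmul τ (pone F n) x = x) ∧
      iSupIndep (invariantsDeg F n) ∧
      (⨆ k, invariantsDeg F n k) = invariants F n ∧
      (∀ k l : ℕ, ∀ x ∈ invariantsDeg F n k, ∀ y ∈ invariantsDeg F n l,
        pmul τ x y ∈ ⨆ m ∈ Set.Iic (k + l), invariantsDeg F n m) ∧
      (τ = .quotient → ∀ x ∈ invariants F n, ∀ y ∈ invariants F n, ∀ z ∈ invariants F n,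
        pmul τ (pmul τ x y) z = pmul τ x (pmul τ y z))) ∧
    -- the maps `φᴺₙ` restrict to surjective morphisms of graded algebras
    (∀ (n N : ℕ) (h : n ≤ N),
      (∀ x ∈ invariants F N, phi F h x ∈ invariants F n) ∧
      (∀ y ∈ invariants F n, ∃ x ∈ invariants F N, phi F h x = y) ∧
      phi F h (pone F N) = pone F n ∧
      (∀ (τ : TrivialityNotion), ∀ x ∈ invariants F N, ∀ y ∈ invariants F N,
        phi F h (pmul τ x y) = pmul τ (phi F h x) (phi F h y)) ∧
      (∀ k : ℕ, ∀ x ∈ invariantsDeg F N k, phi F h x ∈ invariantsDeg F n k)) ∧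
    -- the classes `Â_{μ,n}` are compatible with these maps
    (∀ (μ : Polypartition F) (n N : ℕ) (h : n ≤ N),
      phi F h (μ.hatA N) = μ.hatA n) ∧
    (∀ (μ : Polypartition F) (n : ℕ),
      μ.hatA n ∈ invariantsDeg F n μ.size ∧
      (μ.size ≤ n → μ.hatA n =
        (qPoch F (n - μ.size) / ((qC F) ^ (n * μ.size) * qPoch F n)) • μ.classA n)) ∧
    -- the maps `φᴺₙ` form an inverse system
    (∀ n : ℕ, phi F (le_refl n) = LinearMap.id) ∧
    (∀ (n m N : ℕ) (h₁ : n ≤ m) (h₂ : m ≤ N),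
      phi F h₁ ∘ₗ phi F h₂ = phi F (h₁.trans h₂)) := by
  refine ⟨fun τ n => ⟨fun x hx y hy => pmul_mem_invariants τ hx hy,
      fun x hx y hy => pmul_comm_of_mem τ hx hy, pone_mem_invariantsDeg,
      fun x hx => pone_pmul τ hx, iSupIndep_invariantsDeg, iSup_invariantsDeg, ?_, ?_⟩,
    fun n N h => ⟨fun x hx => phi_mem_invariants h hx, fun y hy => exists_phi_eq h hy, phi_pone h,
      fun τ x hx y hy => phi_pmul h τ hx hy, fun k x hx => phi_mem_invariantsDeg h hx⟩,
    fun μ n N h => μ.phi_hatA h,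
    fun μ n => ⟨μ.hatA_mem_invariantsDeg, fun hk => μ.hatA_eq_of_le hk⟩,
    fun n => phi_refl, fun n m N h₁ h₂ => phi_comp h₁ h₂⟩
  · intro k l x hx y hy
    exact mem_iSup_invariantsDeg (pmul_mem_invariants τ hx.1 hy.1) _
      (pmul_mem_supported τ hx.2 hy.2)
  · rintro rfl x hx y hy z hz
    exact pmul_assoc_of_mem hx hy hz
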